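/- Fix $d$ and compact metric spaces $X,Y$ of labels. A labeled Delone set is the graph $\Lambda$ of a map from a Delone set of $\mathbb R^d$ (uniformly discrete and relatively dense) to a label space. (Tilings are encoded in this way by puncturing their tiles.) Labeled Delone sets carry the topology in which $\Lambda,\Lambda'$ are close if, for a small $\varepsilon>0$, they correspond one-to-one on the ball of radius $1/\varepsilon$ up to moving points and labels by less than $\varepsilon$. The tiling space (hull) of $\Lambda$ is $\Omega=\overline{\{\Lambda-x : x\in\mathbb R^d\}}$ with the translation action $T\mapsto T-x$. $\Lambda$ has finite local complexity (FLC) if for every radius it has finitely many patches up to translation. A function on $\Omega$ is strongly pattern-equivariant (PE) if, for some $R$, its value at $T$ depends only on $T\cap B(0,R)$. *Cohomology.* A weak 1-cocycle is a continuous $\alpha:\Omega\times\mathbb R^d\to\mathbb R^d$ with $\alpha(T,x)+\alpha(T-x,y)=\alpha(T,x+y)$. It is strong if $\alpha(\cdot,v)$ is strongly PE for every $v$. Weak (resp. strong) coboundaries are the cocycles $\delta s(T,v)=s(T-v)-s(T)$ with $s:\Omega\to\mathbb R^d$ continuous (resp. continuous and strongly PE). The quotients are $H^1_w(\Omega;\mathbb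 R^d)$ and $H^1_s(\Omega;\mathbb R^d)$. *Ruelle–Sullivan map.* A closed weakly PE 1-form is a map $\omega:\Omega\to\mathrm{End}(\mathbb R^d)$ such that, for each $T$, $x\mapsto\omega(T-x)$ is a smooth closed $\mathbb R^d$-valued 1-form on $\mathbb R^d$, and such that all derivatives of these forms (including order $0$), evaluated at $x=0$, depend continuously on $T$. It corresponds to the cocycle $\alpha$ for which $\alpha(T,\cdot)$ is the primitive of $x\mapsto\omega(T-x)$ vanishing at $0$, and it represents the class of $\alpha$; classes in $H^1_s$ are represented by strongly PE forms with a strong cocycle. For an invariant probability measure $\mu$ on $\Omega$, $C_\mu(c)=\int_\Omega\omega\,d\mu$ (a $d\times d$ matrix) for any form $\omega$ representing $c$. *The class of $h$.* Let $h:\Omega\to\Omega'$ be a homeomorphism. It is an orbit equivalence if it maps every $\mathbb R^d$-orbit onto an $\mathbb R^d$-orbit; then $[h]\in H^1_w(\Omega;\mathbb R^d)$ is the class of the cocycle $(T,x)\mapsto h_T(x)$ defined by $h(T-x)=h(T)-h_T(x)$. If $\Omega$ and $\Omega'$ have FLC, every homeomorphism is an orbit equivalence, and it has in addition a strong class $[h]\in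 H^1_s(\Omega;\mathbb R^d)$: the class of the cocycle of any map $h_s(T)=h(T)-s(T)$, $s:\Omega\to\mathbb R^d$ continuous, which is local (for every $r>0$ there is $R>0$ such that $T\cap B(0,R)$ determines $h_s(T)\cap B(0,r)$). **Theorem.** Let $\Omega$ and $\Omega'$ be the tiling spaces of labeled Delone sets $\Lambda,\Lambda'$ of $\mathbb R^d$ with labels in $X$ and $Y$. Suppose that both spaces are minimal (every orbit is dense) and aperiodic (no element has a nonzero period), and that $\Omega$ is uniquely ergodic, with invariant probability measure $\mu$. Let $h:\Omega\to\Omega'$ be a homeomorphism, and suppose that $h$ is an orbit equivalence or that both $\Lambda$ and $\Lambda'$ have FLC. Then the class $[h]\in H^1_w(\Omega;\mathbb R^d)$ and its Ruelle–Sullivan matrix $C_\mu[h]$ are well defined, and $C_\mu[h]$ is invertible. If both $\Lambda$ and $\Lambda'$ have FLC, then the strong class $[h]\in H^1_s(\Omega;\mathbb R^d)$ and its Ruelle–Sullivan matrix are also well defined, and that matrix is the same invertible matrix. -/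

import Mathlib

open MeasureTheory Topology
open scoped ContDiff

noncomputable section

namespace Tiling

/-- Euclidean `d`-space. -/
abbrev Euc (d : ℕ) : Type := EuclideanSpace ℝ (Fin d)

variable {d : ℕ} {X Y : Type*} [MetricSpace X] [MetricSpace Y]

/-- A labeled Delone set of `ℝ^d` with labels in `X`, given as the graph of its label map, i.e. as
the set of pairs (point, label). Uniform discreteness is imposed on distinct elements of the graph,
so it also says that every point carries exactly one label. -/
@[ext]
structure DeloneSet (d : ℕ) (X : Type*) [MetricSpace X] where
  carrier : Set (Euc d × X)
  uniformlyDiscrete : ∃ r > 0, ∀ p ∈ carrier, ∀ q ∈ carrier, p ≠ q → r ≤ dist p.1 q.1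
  relativelyDense : ∃ R > 0, ∀ x : Euc d, ∃ p ∈ carrier, dist p.1 x < R

namespace DeloneSet

/-- The translate `Λ - x`; labels are carried along. -/
def translate (Λ : DeloneSet d X) (x : Euc d) : DeloneSet d X where
  carrier := {p | (p.1 + x, p.2) ∈ Λ.carrier}
  uniformlyDiscrete := by
    obtain ⟨r, hr, h⟩ := Λ.uniformlyDiscrete
    refine ⟨r, hr, fun p hp q hq hpq => ?_⟩
    have := h _ hp _ hq (fun he => hpq (by
      have h1 := congrArg Prod.fst he
      have h2 := congrArg Prod.snd he
      exact Prod.ext (add_right_cancel h1) h2))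
    simpa using this
  relativelyDense := by
    obtain ⟨R, hR, h⟩ := Λ.relativelyDense
    refine ⟨R, hR, fun y => ?_⟩
    obtain ⟨p, hp, hd⟩ := h (y + x)
    refine ⟨(p.1 - x, p.2), by simpa using hp, ?_⟩
    rw [dist_eq_norm] at hd ⊢
    simpa [sub_sub, add_comm] using hd

instance : HSub (DeloneSet d X) (Euc d) (DeloneSet d X) := ⟨translate⟩

theorem mem_sub {Λ : DeloneSet d X} {x : Euc d} {p : Euc d × X} :
    p ∈ (Λ - x).carrier ↔ (p.1 + x, p.2) ∈ Λ.carrier := Iff.rfl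

theorem sub_sub_eq (Λ : DeloneSet d X) (x y : Euc d) : Λ - x - y = Λ - (x + y) := by
  ext p
  simp only [mem_sub, add_assoc, add_comm x y]

/-- The patch of `Λ` in the open ball of radius `R` about the origin. -/
def patch (Λ : DeloneSet d X) (R : ℝ) : Set (Euc d × X) := {p ∈ Λ.carrier | ‖p.1‖ < R}

theorem patch_mono {Λ Λ' : DeloneSet d X} {r R : ℝ} (h : r ≤ R)
    (hp : Λ.patch R = Λ'.patch R) : Λ.patch r = Λ'.patch r := by
  ext p
  have := Set.ext_iff.1 hp p
  simp only [patch, Set.mem_ofPred_eq] at this ⊢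
  constructor
  · rintro ⟨a, b⟩
    exact ⟨(this.1 ⟨a, b.trans_le h⟩).1, b⟩
  · rintro ⟨a, b⟩
    exact ⟨(this.2 ⟨a, b.trans_le h⟩).1, b⟩

/-- Finite local complexity: for every radius, there are finitely many patches of that radius
up to translation. -/
def IsFLC (Λ : DeloneSet d X) : Prop :=
  ∀ R : ℝ, ∃ S : Set (Set (Euc d × X)), S.Finite ∧
    ∀ x : Euc d, ∃ P ∈ S, ∃ y : Euc d, (Λ - x).patch R = (fun p => (p.1 + y, p.2)) '' P

/-- There is a one-to-one map from the part of `Λ` in the ball of radius `1/ε` to `Λ'` that moves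
points and labels by less than `ε`. -/
def MatchesInto (ε : ℝ) (Λ Λ' : DeloneSet d X) : Prop :=
  ∃ φ : Euc d × X → Euc d × X, Set.InjOn φ (Λ.patch ε⁻¹) ∧
    ∀ p ∈ Λ.patch ε⁻¹, φ p ∈ Λ'.carrier ∧ dist (φ p).1 p.1 < ε ∧ dist (φ p).2 p.2 < ε

/-- The basic entourages: `Λ` and `Λ'` correspond to each other on the ball of radius `1/ε`, up to
displacements of points and changes of labels smaller than `ε`. -/
def entourage (d : ℕ) (X : Type*) [MetricSpace X] (ε : ℝ) : Set (DeloneSet d X × DeloneSet d X) :=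
  {z | MatchesInto ε z.1 z.2 ∧ MatchesInto ε z.2 z.1}

theorem MatchesInto.mono {ε δ : ℝ} (hε : 0 < ε) (h : ε ≤ δ) {Λ Λ' : DeloneSet d X}
    (hm : MatchesInto ε Λ Λ') : MatchesInto δ Λ Λ' := by
  obtain ⟨φ, hi, hφ⟩ := hm
  have hs : Λ.patch δ⁻¹ ⊆ Λ.patch ε⁻¹ := fun p hp =>
    ⟨hp.1, hp.2.trans_le (inv_anti₀ hε h)⟩
  exact ⟨φ, hi.mono hs, fun p hp => ⟨(hφ p (hs hp)).1, (hφ p (hs hp)).2.1.trans_le h,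
    (hφ p (hs hp)).2.2.trans_le h⟩⟩

theorem MatchesInto.refl {ε : ℝ} (hε : 0 < ε) (Λ : DeloneSet d X) : MatchesInto ε Λ Λ :=
  ⟨id, Set.injOn_id _, fun p hp => ⟨hp.1, by simpa, by simpa⟩⟩

theorem MatchesInto.comp {ε δ : ℝ} (hδ : 0 < δ) (hδε : 2 * δ ≤ ε) (hδ1 : 2 * δ ≤ 1)
    {Λ Λ' Λ'' : DeloneSet d X} (h : MatchesInto δ Λ Λ') (h' : MatchesInto δ Λ' Λ'') :
    MatchesInto ε Λ Λ'' := by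
  obtain ⟨φ, hi, hφ⟩ := h
  obtain ⟨ψ, hj, hψ⟩ := h'
  have h2 : (1 : ℝ) ≤ δ⁻¹ / 2 := by
    rw [le_div_iff₀ two_pos, le_inv_comm₀ (by norm_num) hδ]; linarith
  have h3 : ε⁻¹ ≤ δ⁻¹ / 2 := by
    have := inv_anti₀ (by positivity) hδε
    rw [mul_inv] at this; linarith
  have hs : Λ.patch ε⁻¹ ⊆ Λ.patch δ⁻¹ := fun p hp => ⟨hp.1, by
    have := hp.2
    linarith⟩
  have hm : ∀ p ∈ Λ.patch ε⁻¹, φ p ∈ Λ'.patch δ⁻¹ := fun p hp => by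
    obtain ⟨a, b, -⟩ := hφ p (hs hp)
    refine ⟨a, ?_⟩
    have h4 := norm_le_norm_add_norm_sub' (φ p).1 p.1
    rw [dist_eq_norm] at b
    have := hp.2
    linarith
  refine ⟨ψ ∘ φ, fun p hp q hq he => hi (hs hp) (hs hq) (hj (hm p hp) (hm q hq) he),
    fun p hp => ?_⟩
  obtain ⟨-, b, c⟩ := hφ p (hs hp)
  obtain ⟨a', b', c'⟩ := hψ _ (hm p hp)
  refine ⟨a', ?_, ?_⟩
  · have := dist_triangle (ψ (φ p)).1 (φ p).1 p.1
    simp only [Function.comp]; linarith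
  · have := dist_triangle (ψ (φ p)).2 (φ p).2 p.2
    simp only [Function.comp]; linarith

theorem MatchesInto.sub {ε δ : ℝ} (hδε : δ ≤ ε) (x : Euc d)
    (hx : ε⁻¹ + ‖x‖ ≤ δ⁻¹) {Λ Λ' : DeloneSet d X} (h : MatchesInto δ Λ Λ') :
    MatchesInto ε (Λ - x) (Λ' - x) := by
  obtain ⟨φ, hi, hφ⟩ := h
  have hm : ∀ p ∈ (Λ - x).patch ε⁻¹, (p.1 + x, p.2) ∈ Λ.patch δ⁻¹ := fun p hp =>
    ⟨hp.1, by
      have := hp.2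
      have := norm_add_le p.1 x
      simp only; linarith⟩
  refine ⟨fun p => ((φ (p.1 + x, p.2)).1 - x, (φ (p.1 + x, p.2)).2), ?_, fun p hp => ?_⟩
  · intro p hp q hq he
    have h1 := congrArg Prod.fst he
    have h2 := congrArg Prod.snd he
    have h3 := hi (hm p hp) (hm q hq) (Prod.ext (sub_left_injective h1) h2)
    have h4 := congrArg Prod.fst h3
    have h5 := congrArg Prod.snd h3
    exact Prod.ext (add_right_cancel h4) h5
  · obtain ⟨a, b, c⟩ := hφ _ (hm p hp)
    refine ⟨?_, ?_, c.trans_le hδε⟩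
    · rw [mem_sub]
      simpa using a
    · rw [dist_eq_norm] at b ⊢
      simp only at b ⊢
      rw [sub_sub, add_comm x]
      exact b.trans_le hδε

theorem entourage_mono {ε δ : ℝ} (hε : 0 < ε) (h : ε ≤ δ) :
    entourage d X ε ⊆ entourage d X δ := fun _ hz => ⟨hz.1.mono hε h, hz.2.mono hε h⟩

/-- The uniformity with basis `entourage d X ε`, `ε > 0`. -/
instance : UniformSpace (DeloneSet d X) :=
  UniformSpace.ofCore
    { uniformity := ⨅ ε : {ε : ℝ // 0 < ε}, Filter.principal (entourage d X ε)
      refl := le_iInf fun ε => by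
        rw [Filter.principal_mono]
        rintro ⟨Λ, Λ'⟩ (h : Λ = Λ')
        subst h
        exact ⟨.refl ε.2 Λ, .refl ε.2 Λ⟩
      symm := Filter.tendsto_iInf.2 fun ε => Filter.tendsto_iInf' ε <|
        Filter.tendsto_principal_principal.2 fun z hz => ⟨hz.2, hz.1⟩
      comp := le_iInf fun ε => by
        have hδ : 0 < min (ε.1 / 2) (1 / 2) := lt_min (half_pos ε.2) (by norm_num)
        have hm := Filter.mem_iInf_of_mem (f := fun ε : {ε : ℝ // 0 < ε} =>
          Filter.principal (entourage d X ε)) ⟨_, hδ⟩ (Filter.mem_principal_self _)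
        refine (Filter.lift'_le hm ?_)
        rw [Filter.principal_mono]
        rintro ⟨Λ, Λ''⟩ ⟨Λ', h, h'⟩
        have h1 : 2 * min (ε.1 / 2) (1 / 2) ≤ ε.1 := by
          linarith [min_le_left (ε.1 / 2) (1 / 2)]
        have h2 : 2 * min (ε.1 / 2) (1 / 2) ≤ 1 := by
          linarith [min_le_right (ε.1 / 2) (1 / 2)]
        exact ⟨h.1.comp hδ h1 h2 h'.1, h'.2.comp hδ h1 h2 h.2⟩ }

theorem hasBasis_uniformity :
    (uniformity (DeloneSet d X)).HasBasis (fun ε : ℝ => 0 < ε) (entourage d X) := by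
  have : (uniformity (DeloneSet d X)) =
      ⨅ ε : {ε : ℝ // 0 < ε}, Filter.principal (entourage d X ε) := rfl
  rw [this]
  have hdir : Directed (· ≥ ·) (fun ε : {ε : ℝ // 0 < ε} => entourage d X ε) := by
    intro a b
    exact ⟨⟨min a.1 b.1, lt_min a.2 b.2⟩, entourage_mono (lt_min a.2 b.2) (min_le_left _ _),
      entourage_mono (lt_min a.2 b.2) (min_le_right _ _)⟩
  have : Nonempty {ε : ℝ // 0 < ε} := ⟨⟨1, one_pos⟩⟩
  constructor
  intro t
  rw [(Filter.hasBasis_iInf_principal hdir).mem_iff]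
  simp

theorem uniformContinuous_sub (x : Euc d) :
    UniformContinuous (fun Λ : DeloneSet d X => Λ - x) := by
  rw [hasBasis_uniformity.uniformContinuous_iff hasBasis_uniformity]
  intro ε hε
  have hpos : 0 < ε⁻¹ + ‖x‖ := by positivity
  have h1 : (ε⁻¹ + ‖x‖)⁻¹ ≤ ε := by
    rw [inv_le_comm₀ hpos hε]; linarith [norm_nonneg x]
  have h2 : ε⁻¹ + ‖x‖ ≤ ((ε⁻¹ + ‖x‖)⁻¹)⁻¹ := by rw [inv_inv]
  exact ⟨(ε⁻¹ + ‖x‖)⁻¹, by positivity, fun Λ Λ' h => ⟨h.1.sub h1 x h2, h.2.sub h1 x h2⟩⟩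

end DeloneSet

/-- The hull `Ω_Λ` of `Λ`: the closure of its set of translates. -/
def Hull (Λ : DeloneSet d X) : Type _ :=
  {T : DeloneSet d X // T ∈ closure (Set.range fun x : Euc d => Λ - x)}

namespace Hull

variable {Λ : DeloneSet d X} {Λ' : DeloneSet d Y}

instance : UniformSpace (Hull Λ) := inferInstanceAs (UniformSpace (Subtype _))

instance : MeasurableSpace (Hull Λ) := borel _

instance : BorelSpace (Hull Λ) := ⟨rfl⟩

theorem sub_mem (T : Hull Λ) (x : Euc d) :
    T.1 - x ∈ closure (Set.range fun x : Euc d => Λ - x) := by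
  refine map_mem_closure (f := fun S : DeloneSet d X => S - x)
    (DeloneSet.uniformContinuous_sub x).continuous T.2 ?_
  rintro _ ⟨y, rfl⟩
  exact ⟨y + x, (DeloneSet.sub_sub_eq Λ y x).symm⟩

/-- The translation action of `ℝ^d` on the hull, written `T - x`. -/
instance : HSub (Hull Λ) (Euc d) (Hull Λ) := ⟨fun T x => ⟨T.1 - x, T.sub_mem x⟩⟩

end Hull

section Dynamics

variable (Λ : DeloneSet d X)

/-- Every orbit is dense. -/
def IsMinimal : Prop := ∀ T : Hull Λ, Dense (Set.range fun x : Euc d => T - x)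

/-- No element of the hull has a nonzero period. -/
def IsAperiodic : Prop := ∀ (T : Hull Λ) (x : Euc d), T - x = T → x = 0

variable {Λ}

/-- A translation-invariant Borel probability measure. -/
structure IsInvariantProbability (μ : Measure (Hull Λ)) : Prop where
  isProbability : IsProbabilityMeasure μ
  invariant : ∀ x : Euc d, μ.map (fun T : Hull Λ => T - x) = μ

/-- The hull is uniquely ergodic, and `μ` is its invariant probability measure. -/
def IsUniquelyErgodic (μ : Measure (Hull Λ)) : Prop :=
  IsInvariantProbability μ ∧ ∀ ν : Measure (Hull Λ), IsInvariantProbability ν → ν = μ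

/-- A homeomorphism is an orbit equivalence if it maps every orbit onto an orbit. -/
def IsOrbitEquivalence {Λ' : DeloneSet d Y} (h : Hull Λ ≃ₜ Hull Λ') : Prop :=
  ∀ T : Hull Λ, h '' (Set.range fun x : Euc d => T - x) = Set.range fun y : Euc d => h T - y

/-- Local maps: the patch of the image around the origin only depends on a patch around the
origin. -/
def IsLocalMap {Λ' : DeloneSet d Y} (φ : Hull Λ → Hull Λ') : Prop :=
  ∀ r > 0, ∃ R > 0, ∀ T T' : Hull Λ,
    T.1.patch R = T'.1.patch R → (φ T).1.patch r = (φ T').1.patch r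

/-- Strong pattern equivariance of a function on the hull. -/
def IsStronglyPE {A : Type*} (f : Hull Λ → A) : Prop :=
  ∃ R > 0, ∀ T T' : Hull Λ, T.1.patch R = T'.1.patch R → f T = f T'

theorem IsStronglyPE.const {A : Type*} (a : A) : IsStronglyPE (fun _ : Hull Λ => a) :=
  ⟨1, one_pos, fun _ _ _ => rfl⟩

theorem IsStronglyPE.comp {A B : Type*} {f : Hull Λ → A} (hf : IsStronglyPE f) (g : A → B) :
    IsStronglyPE (fun T => g (f T)) := by
  obtain ⟨R, hR, h⟩ := hf
  exact ⟨R, hR, fun T T' hT => congrArg g (h T T' hT)⟩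

theorem IsStronglyPE.comp₂ {A B C : Type*} {f : Hull Λ → A} {f' : Hull Λ → B}
    (hf : IsStronglyPE f) (hf' : IsStronglyPE f') (g : A → B → C) :
    IsStronglyPE (fun T => g (f T) (f' T)) := by
  obtain ⟨R, hR, h⟩ := hf
  obtain ⟨R', -, h'⟩ := hf'
  refine ⟨max R R', lt_max_of_lt_left hR, fun T T' hT => ?_⟩
  simp only [h T T' (DeloneSet.patch_mono (le_max_left _ _) hT),
    h' T T' (DeloneSet.patch_mono (le_max_right _ _) hT)]

end Dynamics

section Cohomology

variable (Λ : DeloneSet d X)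

/-- Weak dynamical `1`-cocycles with values in `ℝ^d`. -/
def weakCocycles : AddSubgroup C(Hull Λ × Euc d, Euc d) where
  carrier := {α | ∀ (T : Hull Λ) (x y : Euc d), α (T, x) + α (T - x, y) = α (T, x + y)}
  zero_mem' := by intro T x y; simp
  add_mem' := by
    intro α β hα hβ T x y
    simp only [ContinuousMap.add_apply, ← hα T x y, ← hβ T x y]
    abel
  neg_mem' := by
    intro α hα T x y
    simp only [ContinuousMap.neg_apply, ← hα T x y]
    abel

/-- Weak coboundaries `δs (T, v) = s (T - v) - s T`, with `s` continuous on the hull. -/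
def weakCoboundaries : AddSubgroup (weakCocycles Λ) where
  carrier := {α | ∃ s : C(Hull Λ, Euc d), ∀ (T : Hull Λ) (v : Euc d),
    α.1 (T, v) = s (T - v) - s T}
  zero_mem' := ⟨0, by intro T v; simp⟩
  add_mem' := by
    rintro α β ⟨s, hs⟩ ⟨t, ht⟩
    refine ⟨s + t, fun T v => ?_⟩
    simp only [AddSubgroup.coe_add, ContinuousMap.add_apply, hs, ht]
    abel
  neg_mem' := by
    rintro α ⟨s, hs⟩
    refine ⟨-s, fun T v => ?_⟩
    simp only [AddSubgroup.coe_neg, ContinuousMap.neg_apply, hs]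
    abel

/-- The weak cohomology group `H¹_w(Ω; ℝ^d)`. -/
abbrev WeakH1 : Type _ := weakCocycles Λ ⧸ weakCoboundaries Λ

/-- Strong dynamical `1`-cocycles: `T ↦ α (T, v)` is strongly pattern equivariant for every `v`. -/
def strongCocycles : AddSubgroup C(Hull Λ × Euc d, Euc d) where
  carrier := {α | α ∈ weakCocycles Λ ∧ ∀ v : Euc d, IsStronglyPE fun T : Hull Λ => α (T, v)}
  zero_mem' := ⟨zero_mem _, fun _ => IsStronglyPE.const 0⟩
  add_mem' := by
    rintro α β ⟨hα, hα'⟩ ⟨hβ, hβ'⟩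
    exact ⟨add_mem hα hβ, fun v => (hα' v).comp₂ (hβ' v) (· + ·)⟩
  neg_mem' := by
    rintro α ⟨hα, hα'⟩
    exact ⟨neg_mem hα, fun v => (hα' v).comp (- ·)⟩

/-- Strong coboundaries `δs`, with `s` continuous and strongly pattern equivariant. -/
def strongCoboundaries : AddSubgroup (strongCocycles Λ) where
  carrier := {α | ∃ s : C(Hull Λ, Euc d), IsStronglyPE s ∧ ∀ (T : Hull Λ) (v : Euc d),
    α.1 (T, v) = s (T - v) - s T}
  zero_mem' := ⟨0, IsStronglyPE.const 0, by intro T v; simp⟩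
  add_mem' := by
    rintro α β ⟨s, hs', hs⟩ ⟨t, ht', ht⟩
    refine ⟨s + t, hs'.comp₂ ht' (· + ·), fun T v => ?_⟩
    simp only [AddSubgroup.coe_add, ContinuousMap.add_apply, hs, ht]
    abel
  neg_mem' := by
    rintro α ⟨s, hs', hs⟩
    refine ⟨-s, hs'.comp (- ·), fun T v => ?_⟩
    simp only [AddSubgroup.coe_neg, ContinuousMap.neg_apply, hs]
    abel

/-- The strong cohomology group `H¹_s(Ω; ℝ^d)`. -/
abbrev StrongH1 : Type _ := strongCocycles Λ ⧸ strongCoboundaries Λ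

/-- Closed, weakly pattern-equivariant, `ℝ^d`-valued `1`-forms. The form on the leaf of `T` is
`x ↦ η (T - x)`; it is smooth, and its derivatives of all orders (including order `0`) are
continuous functions on the hull. -/
structure PEForm where
  toFun : Hull Λ → (Euc d →L[ℝ] Euc d)
  smooth : ∀ T : Hull Λ, ContDiff ℝ ∞ fun x : Euc d => toFun (T - x)
  equivariant : ∀ n : ℕ, Continuous fun T : Hull Λ =>
    iteratedFDeriv ℝ n (fun x : Euc d => toFun (T - x)) 0
  closed : ∀ (T : Hull Λ) (x u v : Euc d),
    fderiv ℝ (fun y : Euc d => toFun (T - y)) x u v =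
      fderiv ℝ (fun y : Euc d => toFun (T - y)) x v u

variable {Λ}

/-- `α (T, ·)` is the primitive, vanishing at `0`, of the form `η` on the leaf of `T`; hence `α` is
the dynamical cocycle corresponding to the closed form `η`. -/
def PEForm.HasPrimitive (η : PEForm Λ) (α : C(Hull Λ × Euc d, Euc d)) : Prop :=
  ∀ (T : Hull Λ) (x : Euc d), HasFDerivAt (fun v : Euc d => α (T, v)) (η.toFun (T - x)) x

/-- The form `η` represents the weak class `c`. -/
def PEForm.RepresentsWeak (η : PEForm Λ) (c : WeakH1 Λ) : Prop :=
  ∃ α : weakCocycles Λ, η.HasPrimitive α.1 ∧ (QuotientAddGroup.mk α : WeakH1 Λ) = c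

/-- The form `η` is strongly pattern equivariant and represents the strong class `c`. -/
def PEForm.RepresentsStrong (η : PEForm Λ) (c : StrongH1 Λ) : Prop :=
  IsStronglyPE η.toFun ∧
    ∃ α : strongCocycles Λ, η.HasPrimitive α.1 ∧ (QuotientAddGroup.mk α : StrongH1 Λ) = c

/-- The matrix `∫ η(T) dμ(T)` in the standard basis. -/
def PEForm.average (μ : Measure (Hull Λ)) (η : PEForm Λ) : Matrix (Fin d) (Fin d) ℝ :=
  Matrix.of fun i j => ∫ T, (η.toFun T (EuclideanSpace.single j 1)) i ∂μ

/-- `C = C_μ(c)` for a weak class `c`: the class is represented by forms, and the average of every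
representative is `C`. -/
structure IsRuelleSullivanWeak (μ : Measure (Hull Λ)) (c : WeakH1 Λ)
    (C : Matrix (Fin d) (Fin d) ℝ) : Prop where
  exists_form : ∃ η : PEForm Λ, η.RepresentsWeak c
  average_eq : ∀ η : PEForm Λ, η.RepresentsWeak c → η.average μ = C

/-- `C = C_μ(c)` for a strong class `c`, computed with strongly pattern-equivariant forms. -/
structure IsRuelleSullivanStrong (μ : Measure (Hull Λ)) (c : StrongH1 Λ)
    (C : Matrix (Fin d) (Fin d) ℝ) : Prop where
  exists_form : ∃ η : PEForm Λ, η.RepresentsStrong c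
  average_eq : ∀ η : PEForm Λ, η.RepresentsStrong c → η.average μ = C

/-- `α` is the cocycle `(T, x) ↦ g_T(x)` of `g`, defined by `g (T - x) = g T - g_T(x)`. -/
def IsCocycleOf {Λ' : DeloneSet d Y} (g : Hull Λ → Hull Λ') (α : C(Hull Λ × Euc d, Euc d)) :
    Prop :=
  ∀ (T : Hull Λ) (x : Euc d), g (T - x) = g T - α (T, x)

/-- `c` is the weak class `[h]`: the class of the cocycle of `h`. -/
def IsWeakClassOf {Λ' : DeloneSet d Y} (h : Hull Λ ≃ₜ Hull Λ') (c : WeakH1 Λ) : Prop :=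
  ∃ α : weakCocycles Λ, IsCocycleOf h α.1 ∧ (QuotientAddGroup.mk α : WeakH1 Λ) = c

/-- `c` is the strong class `[h]`: the class of the cocycle of a local map of the form
`h_s(T) = h(T) - s(T)` with `s` continuous. -/
def IsStrongClassOf {Λ' : DeloneSet d Y} (h : Hull Λ ≃ₜ Hull Λ') (c : StrongH1 Λ) : Prop :=
  ∃ s : C(Hull Λ, Euc d), IsLocalMap (fun T => h T - s T) ∧
    ∃ α : strongCocycles Λ, IsCocycleOf (fun T => h T - s T) α.1 ∧
      (QuotientAddGroup.mk α : StrongH1 Λ) = c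

end Cohomology

end Tiling

end

/-!
The displacements in `h (T - x) = h T - α (T, x)` are unique by aperiodicity of `Ω'`, hence form a
cocycle. To see that they exist and are continuous, move to the origin the point of `h (T - x)`
which follows a given point of `h T`: for small `x` this is a continuous map into the part of the
transversal of `Ω'` met by the image of the orbit of `T`. That part is countable for an orbit
equivalence, and the whole transversal is totally disconnected with FLC, so the map is constant and
small translations go to small translations. The inverse homeomorphism has a cocycle which inverts
`α` along orbits, so `α` is coarsely expanding: `‖x‖ ≤ K (‖α (T, x)‖ + 1)`.

Averaging a cocycle against a bump function changes it by a coboundary and makes it smooth, with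
derivatives continuous on the hull, so that it is the primitive of a form. Integrating the primitive
and using the invariance of `μ`, the average of every form in the class of `α` is the matrix of the
linear map `x ↦ ∫ α (T, x) ∂μ`. By the mean ergodic theorem `α (T, n x) / n` converges in mean
square. Since `α (T - y, n x)` and `α (T, n x)` differ by an amount bounded in `n`, the limit is
invariant under the whole action, so by ergodicity it is the constant `∫ α (T, x) ∂μ`. By the coarse
expansion this constant is not zero unless `x = 0`.

With FLC, the restriction of `h` to the transversal of `Ω`, followed by a suitable continuous
translation into the transversal of `Ω'`, is determined by patches. Each point of `T` near the
origin thus gives a displacement making `h` local, and a weighted average of these displacements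
over the points near the origin gives a continuous `s` with `h - s` local. The cocycle of `h - s` is
strongly pattern-equivariant and differs from `α` by the coboundary of `s`, so it has the same
Ruelle–Sullivan matrix.
-/

noncomputable section

namespace Tiling

open Filter Metric Uniformity

variable {d : ℕ} {X Y : Type*} [MetricSpace X] [MetricSpace Y]

/-! ### The space of labeled Delone sets -/

/-- Uniform discreteness of a labeled set with constant `r`: distinct elements of the graph lie over
points at distance at least `r`. -/
def IsSeparatedBy {X : Type*} (r : ℝ) (A : Set (Euc d × X)) : Prop :=
  A.Pairwise fun p q => r ≤ dist p.1 q.1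

/-- Relative density of a labeled set with constant `R`: every closed ball of radius `R` contains
one of its points. -/
def IsCoveringBy {X : Type*} (R : ℝ) (A : Set (Euc d × X)) : Prop :=
  ∀ x : Euc d, ∃ p ∈ A, dist p.1 x ≤ R

theorem IsSeparatedBy.eq_of_dist_lt {X : Type*} {r : ℝ} {A : Set (Euc d × X)}
    (h : IsSeparatedBy r A) {p q : Euc d × X} (hp : p ∈ A) (hq : q ∈ A)
    (hpq : dist p.1 q.1 < r) : p = q :=
  h.eq hp hq hpq.not_ge

theorem IsSeparatedBy.isClosed {r : ℝ} (hr : 0 < r) {A : Set (Euc d × X)}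
    (h : IsSeparatedBy r A) : IsClosed A :=
  isClosed_of_pairwise_le_dist hr (h.mono' fun _ _ hpq => hpq.trans (le_max_left _ _))

namespace DeloneSet

theorem exists_isSeparatedBy (S : DeloneSet d X) : ∃ r > 0, IsSeparatedBy r S.carrier := by
  obtain ⟨r, hr, h⟩ := S.uniformlyDiscrete
  exact ⟨r, hr, fun p hp q hq => h p hp q hq⟩

theorem exists_isCoveringBy (S : DeloneSet d X) : ∃ R > 0, IsCoveringBy R S.carrier := by
  obtain ⟨R, hR, h⟩ := S.relativelyDense
  refine ⟨R, hR, fun x => ?_⟩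
  obtain ⟨p, hp, hpx⟩ := h x
  exact ⟨p, hp, hpx.le⟩

theorem isClosed_carrier (S : DeloneSet d X) : IsClosed S.carrier := by
  obtain ⟨r, hr, h⟩ := S.exists_isSeparatedBy
  exact h.isClosed hr

theorem isSeparatedBy_sub {r : ℝ} {S : DeloneSet d X} (h : IsSeparatedBy r S.carrier)
    (x : Euc d) : IsSeparatedBy r (S - x).carrier := fun p hp q hq hpq => by
  simpa using h hp hq (((add_left_injective x).prodMap Function.injective_id).ne hpq)

theorem isCoveringBy_sub {R : ℝ} {S : DeloneSet d X} (h : IsCoveringBy R S.carrier)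
    (x : Euc d) : IsCoveringBy R (S - x).carrier := fun y => by
  obtain ⟨p, hp, hpy⟩ := h (y + x)
  refine ⟨(p.1 - x, p.2), by simpa [mem_sub] using hp, ?_⟩
  rwa [← dist_add_right _ _ x, sub_add_cancel]

theorem finite_patch (S : DeloneSet d X) (R : ℝ) : (S.patch R).Finite := by
  obtain ⟨r, hr, h⟩ := S.exists_isSeparatedBy
  obtain ⟨t, -, ht, hcov⟩ := finite_cover_balls_of_compact
    (isCompact_closedBall (0 : Euc d) R) (half_pos hr)
  refine (ht.biUnion (t := fun y => {p ∈ S.carrier | dist p.1 y < r / 2})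
    fun y _ => Set.Subsingleton.finite fun p hp q hq => ?_).subset fun p hp => ?_
  · refine h.eq_of_dist_lt hp.1 hq.1 ?_
    linarith [dist_triangle_right p.1 q.1 y, hp.2, hq.2]
  · obtain ⟨y, hy, hpy⟩ := Set.mem_iUnion₂.1 (hcov (mem_closedBall_zero_iff.2 hp.2.le))
    exact Set.mem_biUnion hy ⟨hp.1, hpy⟩

theorem countable_carrier (S : DeloneSet d X) : S.carrier.Countable := by
  refine (Set.countable_iUnion fun n : ℕ => (S.finite_patch n).countable).mono fun p hp => ?_
  obtain ⟨n, hn⟩ := exists_nat_gt ‖p.1‖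
  exact Set.mem_iUnion.2 ⟨n, hp, hn⟩

protected theorem sub_zero (S : DeloneSet d X) : S - (0 : Euc d) = S := by
  ext p
  simp only [mem_sub, add_zero]

theorem eq_of_forall_patch_eq {S T : DeloneSet d X} (h : ∀ R, S.patch R = T.patch R) : S = T := by
  ext p
  simpa [patch] using Set.ext_iff.1 (h (‖p.1‖ + 1)) p

theorem patch_subset_thickening_mem_uniformity (R : ℝ) {ε : ℝ} (hε : 0 < ε) :
    {z : DeloneSet d X × DeloneSet d X | z.1.patch R ⊆ thickening ε z.2.carrier} ∈
      𝓤 (DeloneSet d X) := by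
  have hδ : 0 < min ε (|R| + 1)⁻¹ := lt_min hε (by positivity)
  have hR : R ≤ (min ε (|R| + 1)⁻¹)⁻¹ := by
    have := inv_anti₀ hδ (min_le_right ε (|R| + 1)⁻¹)
    rw [inv_inv] at this
    linarith [le_abs_self R]
  refine hasBasis_uniformity.mem_iff.2 ⟨_, hδ, fun z hz p hp => ?_⟩
  obtain ⟨φ, -, hφ⟩ := hz.1
  obtain ⟨hφp, h1, h2⟩ := hφ p ⟨hp.1, hp.2.trans_le hR⟩
  refine mem_thickening_iff.2 ⟨φ p, hφp, ?_⟩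
  rw [dist_comm]
  exact max_lt (h1.trans_le (min_le_left _ _)) (h2.trans_le (min_le_left _ _))

theorem eventually_patch_subset_thickening (T : DeloneSet d X) (R : ℝ) {ε : ℝ} (hε : 0 < ε) :
    ∀ᶠ S in 𝓝 T, S.patch R ⊆ thickening ε T.carrier :=
  mem_nhds_right T (patch_subset_thickening_mem_uniformity R hε)

theorem eventually_mem_thickening {T : DeloneSet d X} {p : Euc d × X} (hp : p ∈ T.carrier)
    {ε : ℝ} (hε : 0 < ε) : ∀ᶠ S in 𝓝 T, p ∈ thickening ε S.carrier := by
  filter_upwards [mem_nhds_left T (patch_subset_thickening_mem_uniformity (‖p.1‖ + 1) hε)]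
    with S hS using hS ⟨hp, lt_add_one _⟩

theorem matchesInto_of_patch_subset_thickening {r ε : ℝ} {S S' : DeloneSet d X}
    (hS : IsSeparatedBy r S.carrier)
    (h : S.patch ε⁻¹ ⊆ thickening (min ε (r / 2)) S'.carrier) : MatchesInto ε S S' := by
  have h' : ∀ p ∈ S.patch ε⁻¹, ∃ q ∈ S'.carrier, dist p q < min ε (r / 2) :=
    fun p hp => mem_thickening_iff.1 (h hp)
  choose! φ hφ hdist using h'
  have hfst (p) (hp : p ∈ S.patch ε⁻¹) : dist p.1 (φ p).1 < min ε (r / 2) :=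
    (le_max_left _ _).trans_lt (hdist p hp)
  refine ⟨φ, fun p hp q hq hpq => hS.eq_of_dist_lt hp.1 hq.1 ?_, fun p hp => ⟨hφ p hp, ?_, ?_⟩⟩
  · have hq' := hfst q hq
    rw [← hpq] at hq'
    linarith [dist_triangle_right p.1 q.1 (φ p).1, hfst p hp, min_le_right ε (r / 2)]
  · rw [dist_comm]
    exact (hfst p hp).trans_le (min_le_left _ _)
  · rw [dist_comm]
    exact (le_max_right _ _).trans_lt ((hdist p hp).trans_le (min_le_left _ _))

theorem mem_entourage_of_patch_eq {ε : ℝ} (hε : 0 < ε) {S T : DeloneSet d X}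
    (h : S.patch ε⁻¹ = T.patch ε⁻¹) : (S, T) ∈ entourage d X ε := by
  have key (S T : DeloneSet d X) (h : S.patch ε⁻¹ = T.patch ε⁻¹) : MatchesInto ε S T :=
    ⟨id, Set.injOn_id _, fun p hp => ⟨(h.subset hp).1, by simpa, by simpa⟩⟩
  exact ⟨key S T h, key T S h.symm⟩

theorem sub_mem_entourage {ε : ℝ} {x y : Euc d} (h : ‖x - y‖ < ε) (S : DeloneSet d X) :
    (S - x, S - y) ∈ entourage d X ε := by
  have hε : 0 < ε := (norm_nonneg _).trans_lt h
  have key (x y : Euc d) (h : ‖x - y‖ < ε) : MatchesInto ε (S - x) (S - y) := by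
    refine ⟨Prod.map (· + (x - y)) id,
      ((add_left_injective _).prodMap Function.injective_id).injOn, fun p hp => ⟨?_, ?_, ?_⟩⟩
    · simpa [mem_sub, add_assoc] using hp.1
    · simpa [dist_eq_norm] using h
    · simpa using hε
  exact ⟨key x y h, key y x (by rwa [norm_sub_rev])⟩

/-- The limit of labeled Delone sets along a filter, as a closed set: the elements that are
approximated by elements of almost all of the sets. -/
def limitSet (F : Filter (DeloneSet d X)) : Set (Euc d × X) :=
  {p | ∀ ε > 0, ∀ᶠ S in F, p ∈ thickening ε S.carrier}

theorem limitSet_eq_carrier {F : Filter (DeloneSet d X)} [F.NeBot] {T : DeloneSet d X}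
    (hF : F ≤ 𝓝 T) : limitSet F = T.carrier := by
  refine Set.Subset.antisymm (fun p hp => ?_)
    fun p hp ε hε => hF (eventually_mem_thickening hp hε)
  rw [← T.isClosed_carrier.closure_eq, Metric.mem_closure_iff]
  intro ε hε
  have hδ : 0 < min (ε / 2) 1 := by positivity
  obtain ⟨S, hpS, hST⟩ := ((hp _ hδ).and
    (hF (T.eventually_patch_subset_thickening (‖p.1‖ + 1) (half_pos hε)))).exists
  obtain ⟨q, hq, hpq⟩ := mem_thickening_iff.1 hpS
  have hpq' : dist q.1 p.1 < 1 := by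
    rw [dist_comm]
    exact (le_max_left _ _).trans_lt (hpq.trans_le (min_le_right _ _))
  have hqR : ‖q.1‖ < ‖p.1‖ + 1 := by
    linarith [norm_le_norm_add_norm_sub' q.1 p.1, dist_eq_norm q.1 p.1]
  obtain ⟨t, ht, hqt⟩ := mem_thickening_iff.1 (hST ⟨hq, hqR⟩)
  exact ⟨t, ht, by linarith [dist_triangle p q t, min_le_left (ε / 2) 1]⟩

theorem isSeparatedBy_limitSet {F : Filter (DeloneSet d X)} {r : ℝ}
    (hF : ∃ᶠ S in F, IsSeparatedBy r S.carrier) : IsSeparatedBy r (limitSet F) := by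
  intro p hp q hq hpq
  refine le_of_forall_pos_le_add fun ε hε => ?_
  have hd : 0 < dist p q := dist_pos.2 hpq
  have hm : 0 < min (ε / 2) (dist p q / 2) := by positivity
  obtain ⟨S, hS, hpS, hqS⟩ := (hF.and_eventually ((hp _ hm).and (hq _ hm))).exists
  obtain ⟨p', hp', hpp'⟩ := mem_thickening_iff.1 hpS
  obtain ⟨q', hq', hqq'⟩ := mem_thickening_iff.1 hqS
  have hne : p' ≠ q' := by
    rintro rfl
    linarith [dist_triangle_right p q p', min_le_right (ε / 2) (dist p q / 2)]
  have h1 : dist p.1 p'.1 ≤ dist p p' := le_max_left _ _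
  have h2 : dist q.1 q'.1 ≤ dist q q' := le_max_left _ _
  linarith [hS hp' hq' hne, dist_triangle4 p'.1 p.1 q.1 q'.1, dist_comm p'.1 p.1,
    min_le_left (ε / 2) (dist p q / 2)]

theorem limitSet_inter_nonempty {F : Ultrafilter (DeloneSet d X)} {K : Set (Euc d × X)}
    (hK : IsCompact K) (hF : ∀ᶠ S in (F : Filter (DeloneSet d X)), (S.carrier ∩ K).Nonempty) :
    (limitSet (F : Filter (DeloneSet d X)) ∩ K).Nonempty := by
  have : Nonempty (Euc d × X) := let ⟨_, p, _⟩ := hF.exists; ⟨p⟩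
  obtain ⟨f, hf⟩ := Eventually.choice hF
  obtain ⟨p, hp, hlim⟩ := hK.ultrafilter_le_nhds (F.map f)
    (le_principal_iff.2 (hf.mono fun S hS => hS.2))
  refine ⟨p, fun ε hε => ?_, hp⟩
  have hball : ∀ᶠ S in (F : Filter (DeloneSet d X)), f S ∈ ball p ε := hlim (ball_mem_nhds p hε)
  filter_upwards [hball, hf] with S hfS hS
  exact mem_thickening_iff.2 ⟨f S, hS.1, by rwa [dist_comm]⟩

theorem isCoveringBy_limitSet [CompactSpace X] {F : Ultrafilter (DeloneSet d X)} {R : ℝ}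
    (hF : ∀ᶠ S in (F : Filter (DeloneSet d X)), IsCoveringBy R S.carrier) :
    IsCoveringBy R (limitSet (F : Filter (DeloneSet d X))) := by
  intro x
  obtain ⟨p, hp, hpx, -⟩ := limitSet_inter_nonempty
    ((isCompact_closedBall x R).prod (isCompact_univ (X := X))) (hF.mono fun S hS => by
      obtain ⟨p, hp, hpx⟩ := hS x
      exact ⟨p, hp, hpx, trivial⟩)
  exact ⟨p, hp, hpx⟩

theorem eventually_patch_subset_thickening_limitSet [CompactSpace X]
    (F : Ultrafilter (DeloneSet d X)) (R : ℝ) {ε : ℝ} (hε : 0 < ε) :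
    ∀ᶠ S in (F : Filter (DeloneSet d X)),
      S.patch R ⊆ thickening ε (limitSet (F : Filter (DeloneSet d X))) := by
  by_contra hcon
  have hK : IsCompact ((closedBall (0 : Euc d) R ×ˢ (Set.univ : Set X)) \
      thickening ε (limitSet (F : Filter (DeloneSet d X)))) :=
    ((isCompact_closedBall _ _).prod isCompact_univ).diff isOpen_thickening
  obtain ⟨p, hp, -, hpε⟩ := limitSet_inter_nonempty hK <|
    (Ultrafilter.eventually_not.2 hcon).mono fun S hS => by
      obtain ⟨p, hp, hpε⟩ := Set.not_subset.1 hS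
      exact ⟨p, hp.1, ⟨mem_closedBall_zero_iff.2 hp.2.le, trivial⟩, hpε⟩
  exact hpε (self_subset_thickening hε _ hp)

theorem le_nhds_of_limitSet_eq [CompactSpace X] {F : Ultrafilter (DeloneSet d X)} {r : ℝ}
    (hr : 0 < r) (hF : ∀ᶠ S in (F : Filter (DeloneSet d X)), IsSeparatedBy r S.carrier)
    {T : DeloneSet d X} (hT : limitSet (F : Filter (DeloneSet d X)) = T.carrier) :
    (F : Filter (DeloneSet d X)) ≤ 𝓝 T := by
  have hTr : IsSeparatedBy r T.carrier := hT ▸ isSeparatedBy_limitSet hF.frequently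
  rw [(nhds_basis_uniformity' hasBasis_uniformity).ge_iff]
  intro ε hε
  have hδ : 0 < min ε (r / 2) := by positivity
  have hTF : ∀ᶠ S in (F : Filter (DeloneSet d X)),
      T.patch ε⁻¹ ⊆ thickening (min ε (r / 2)) S.carrier :=
    (T.finite_patch ε⁻¹).eventually_all.2 fun p hp => (hT.superset hp.1 :) _ hδ
  have hFT := eventually_patch_subset_thickening_limitSet F ε⁻¹ hδ
  rw [hT] at hFT
  filter_upwards [hTF, hFT, hF] with S hTS hST hS
  exact ⟨matchesInto_of_patch_subset_thickening hTr hTS,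
    matchesInto_of_patch_subset_thickening hS hST⟩

theorem isClosed_setOf_isSeparatedBy (r : ℝ) :
    IsClosed {S : DeloneSet d X | IsSeparatedBy r S.carrier} :=
  isClosed_iff_frequently.2 fun T hT => by
    simpa only [Set.mem_ofPred_eq, limitSet_eq_carrier le_rfl] using isSeparatedBy_limitSet hT

theorem isClosed_setOf_isCoveringBy [CompactSpace X] (R : ℝ) :
    IsClosed {S : DeloneSet d X | IsCoveringBy R S.carrier} :=
  isClosed_iff_ultrafilter.2 fun T F hFT hF => by
    simpa only [Set.mem_ofPred_eq, limitSet_eq_carrier hFT] using isCoveringBy_limitSet hF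

theorem isCompact_setOf_isSeparatedBy_isCoveringBy [CompactSpace X] {r : ℝ} (hr : 0 < r)
    (R : ℝ) : IsCompact {S : DeloneSet d X | IsSeparatedBy r S.carrier ∧
      IsCoveringBy R S.carrier} := by
  refine isCompact_iff_ultrafilter_le_nhds.2 fun F hF => ?_
  obtain ⟨hsep, hcov⟩ := eventually_and.1 (le_principal_iff.1 hF)
  have hsep' := isSeparatedBy_limitSet hsep.frequently
  have hcov' := isCoveringBy_limitSet hcov
  let T : DeloneSet d X :=
    { carrier := limitSet F
      uniformlyDiscrete := ⟨r, hr, fun p hp q hq => hsep' hp hq⟩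
      relativelyDense := ⟨|R| + 1, by positivity, fun x => by
        obtain ⟨p, hp, hpx⟩ := hcov' x
        exact ⟨p, hp, by linarith [le_abs_self R]⟩⟩ }
  exact ⟨T, ⟨hsep', hcov'⟩, le_nhds_of_limitSet_eq hr hsep rfl⟩

instance : T0Space (DeloneSet d X) :=
  ⟨fun S T h => DeloneSet.ext <| by
    rw [← limitSet_eq_carrier (le_refl (𝓝 S)), ← limitSet_eq_carrier (le_refl (𝓝 T)), h.nhds_eq]⟩

instance : IsCountablyGenerated (𝓤 (DeloneSet d X)) := by
  have : (𝓤 (DeloneSet d X)).HasBasis (fun _ : ℕ => True)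
      (fun n => entourage d X ((n : ℝ) + 1)⁻¹) := by
    refine hasBasis_uniformity.to_hasBasis (fun ε hε => ?_) fun n _ => ⟨_, by positivity, le_rfl⟩
    obtain ⟨n, hn⟩ := exists_nat_gt ε⁻¹
    refine ⟨n, trivial, entourage_mono (by positivity) ?_⟩
    rw [inv_le_comm₀ (by positivity) hε]
    linarith
  exact this.isCountablyGenerated

end DeloneSet

namespace DeloneSet

theorem continuous_sub : Continuous fun z : DeloneSet d X × Euc d => z.1 - z.2 := by
  refine continuous_iff_continuousAt.2 fun ⟨T, x⟩ => Uniform.tendsto_nhds_right.2 ?_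
  intro V hV
  obtain ⟨W, hW, hWV⟩ := comp_mem_uniformity_sets hV
  obtain ⟨δ, hδ, hδW⟩ := hasBasis_uniformity.mem_iff.1 hW
  have hS : ∀ᶠ S : DeloneSet d X in 𝓝 T, (T - x, S - x) ∈ W :=
    (uniformContinuous_sub x).continuous.continuousAt (mem_nhds_left _ hW)
  rw [nhds_prod_eq, mem_map]
  filter_upwards [hS.prod_mk (ball_mem_nhds x hδ)] with z hz
  exact hWV ⟨z.1 - x, hz.1, hδW (sub_mem_entourage (by
    rw [← dist_eq_norm, dist_comm]; exact hz.2) z.1)⟩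

/-- The underlying point set, without labels. -/
def points (S : DeloneSet d X) : Set (Euc d) := Prod.fst '' S.carrier

theorem mem_points_sub {S : DeloneSet d X} {x y : Euc d} :
    y ∈ (S - x).points ↔ y + x ∈ S.points := by
  constructor
  · rintro ⟨p, hp, rfl⟩
    exact ⟨_, hp, rfl⟩
  · rintro ⟨⟨_, l⟩, hp, rfl⟩
    exact ⟨(y, l), hp, rfl⟩

theorem countable_points (S : DeloneSet d X) : S.points.Countable := S.countable_carrier.image _

end DeloneSet

theorem IsSeparatedBy.pairwise_points {r : ℝ} {S : DeloneSet d X}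
    (h : IsSeparatedBy r S.carrier) : S.points.Pairwise fun p q => r ≤ dist p q := by
  rintro _ ⟨p, hp, rfl⟩ _ ⟨q, hq, rfl⟩ hpq
  exact h hp hq (ne_of_apply_ne Prod.fst hpq)

namespace DeloneSet

theorem isClosed_points (S : DeloneSet d X) : IsClosed S.points := by
  obtain ⟨r, hr, h⟩ := S.exists_isSeparatedBy
  exact isClosed_of_pairwise_le_dist hr h.pairwise_points

end DeloneSet

/-! ### The hull as a topological dynamical system -/

namespace Hull

variable {Λ : DeloneSet d X} {Λ' : DeloneSet d Y}

@[ext]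
theorem ext {S T : Hull Λ} (h : S.1 = T.1) : S = T := Subtype.ext h

protected theorem sub_sub_eq (T : Hull Λ) (x y : Euc d) : T - x - y = T - (x + y) :=
  ext (DeloneSet.sub_sub_eq T.1 x y)

@[simp]
protected theorem sub_zero (T : Hull Λ) : T - (0 : Euc d) = T := ext T.1.sub_zero

instance : Nonempty (Hull Λ) := ⟨⟨Λ, subset_closure ⟨0, Λ.sub_zero⟩⟩⟩

instance : T0Space (Hull Λ) := inferInstanceAs (T0Space (Subtype _))

instance : IsCountablyGenerated (𝓤 (Hull Λ)) :=
  inferInstanceAs (IsCountablyGenerated (comap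
    (fun z : Hull Λ × Hull Λ => (z.1.1, z.2.1)) (𝓤 (DeloneSet d X))))

theorem uniformContinuous_val : UniformContinuous (Subtype.val : Hull Λ → DeloneSet d X) :=
  uniformContinuous_subtype_val

@[fun_prop]
theorem continuous_sub {Z : Type*} [TopologicalSpace Z] {f : Z → Hull Λ} {g : Z → Euc d}
    (hf : Continuous f) (hg : Continuous g) : Continuous fun z => f z - g z :=
  (DeloneSet.continuous_sub.comp
    ((uniformContinuous_val.continuous.comp hf).prodMk hg)).subtype_mk _

theorem continuousOn_sub {Z : Type*} [TopologicalSpace Z] {f : Z → Hull Λ} {g : Z → Euc d}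
    {s : Set Z} (hf : ContinuousOn f s) (hg : ContinuousOn g s) :
    ContinuousOn (fun z => f z - g z) s :=
  (continuous_sub continuous_fst continuous_snd).comp_continuousOn (hf.prodMk hg)

theorem exists_isSeparatedBy (Λ : DeloneSet d X) :
    ∃ r > 0, ∀ T : Hull Λ, IsSeparatedBy r T.1.carrier := by
  obtain ⟨r, hr, h⟩ := Λ.exists_isSeparatedBy
  exact ⟨r, hr, fun T => closure_minimal (Set.range_subset_iff.2 (DeloneSet.isSeparatedBy_sub h))
    (DeloneSet.isClosed_setOf_isSeparatedBy r) T.2⟩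

theorem exists_isCoveringBy [CompactSpace X] (Λ : DeloneSet d X) :
    ∃ R > 0, ∀ T : Hull Λ, IsCoveringBy R T.1.carrier := by
  obtain ⟨R, hR, h⟩ := Λ.exists_isCoveringBy
  exact ⟨R, hR, fun T => closure_minimal (Set.range_subset_iff.2 (DeloneSet.isCoveringBy_sub h))
    (DeloneSet.isClosed_setOf_isCoveringBy R) T.2⟩

instance [CompactSpace X] : CompactSpace (Hull Λ) := by
  obtain ⟨r, hr, hsep⟩ := exists_isSeparatedBy Λ
  obtain ⟨R, -, hcov⟩ := exists_isCoveringBy Λ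
  exact isCompact_iff_compactSpace.1 <|
    (DeloneSet.isCompact_setOf_isSeparatedBy_isCoveringBy hr R).of_isClosed_subset
      isClosed_closure fun T hT => ⟨hsep ⟨T, hT⟩, hcov ⟨T, hT⟩⟩

theorem exists_forall_sub_mem {V : Set (Hull Λ × Hull Λ)} (hV : V ∈ 𝓤 (Hull Λ)) :
    ∃ δ > 0, ∀ (T : Hull Λ) (x y : Euc d), ‖x - y‖ < δ → (T - x, T - y) ∈ V := by
  obtain ⟨ε, hε, h⟩ := (DeloneSet.hasBasis_uniformity.comap _).mem_iff.1 hV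
  exact ⟨ε, hε, fun T x y hxy => h (DeloneSet.sub_mem_entourage hxy T.1)⟩

theorem exists_forall_patch_eq_mem {V : Set (Hull Λ × Hull Λ)} (hV : V ∈ 𝓤 (Hull Λ)) :
    ∃ R > 0, ∀ S T : Hull Λ, S.1.patch R = T.1.patch R → (S, T) ∈ V := by
  obtain ⟨ε, hε, h⟩ := (DeloneSet.hasBasis_uniformity.comap _).mem_iff.1 hV
  exact ⟨ε⁻¹, by positivity, fun S T hST => h (DeloneSet.mem_entourage_of_patch_eq hε hST)⟩

theorem patch_subset_thickening_mem_uniformity (R : ℝ) {ε : ℝ} (hε : 0 < ε) :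
    {z : Hull Λ × Hull Λ | z.1.1.patch R ⊆ thickening ε z.2.1.carrier} ∈ 𝓤 (Hull Λ) :=
  uniformContinuous_val (DeloneSet.patch_subset_thickening_mem_uniformity R hε)

/-! ### Points near a given position -/

theorem eventually_mem_thickening_points {T : Hull Λ} {p : Euc d} (hp : p ∈ T.1.points) {ε : ℝ}
    (hε : 0 < ε) : ∀ᶠ S : Hull Λ in 𝓝 T, p ∈ thickening ε S.1.points := by
  obtain ⟨p, hp, rfl⟩ := hp
  filter_upwards [uniformContinuous_val.continuous.continuousAt
    (DeloneSet.eventually_mem_thickening hp hε)] with S hS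
  obtain ⟨q, hq, hpq⟩ := mem_thickening_iff.1 hS
  exact mem_thickening_iff.2 ⟨q.1, ⟨q, hq, rfl⟩, (le_max_left _ _).trans_lt hpq⟩

theorem isOpen_setOf_mem_thickening_points (η : ℝ) (p : Euc d) :
    IsOpen {S : Hull Λ | p ∈ thickening η S.1.points} := by
  refine isOpen_iff_mem_nhds.2 fun T hT => ?_
  obtain ⟨q, hq, hpq⟩ := mem_thickening_iff.1 hT
  filter_upwards [eventually_mem_thickening_points hq (sub_pos.2 hpq)] with S hS
  obtain ⟨q', hq', hqq'⟩ := mem_thickening_iff.1 hS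
  exact mem_thickening_iff.2 ⟨q', hq', by linarith [dist_triangle p q q']⟩

end Hull

namespace DeloneSet

open Classical in
/-- The point of `S` within distance `η` of `p`. It is unique if `S` is separated by `2 * η`; if
there is no such point, the value is `0`. -/
def nearPoint (η : ℝ) (p : Euc d) (S : DeloneSet d X) : Euc d :=
  if h : ∃ q ∈ S.points, dist p q < η then h.choose else 0

theorem nearPoint_spec {η : ℝ} {p : Euc d} {S : DeloneSet d X} (h : p ∈ thickening η S.points) :
    nearPoint η p S ∈ S.points ∧ dist p (nearPoint η p S) < η := by
  have h' : ∃ q ∈ S.points, dist p q < η := mem_thickening_iff.1 h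
  rw [nearPoint, dif_pos h']
  exact h'.choose_spec

theorem nearPoint_eq {r η : ℝ} {S : DeloneSet d X} (h : IsSeparatedBy r S.carrier)
    (hη : 2 * η ≤ r) {p q : Euc d} (hq : q ∈ S.points) (hpq : dist p q < η) :
    nearPoint η p S = q := by
  obtain ⟨hmem, hdist⟩ := nearPoint_spec (mem_thickening_iff.2 ⟨q, hq, hpq⟩)
  refine h.pairwise_points.eq hmem hq (not_le.2 ?_)
  linarith [dist_triangle_left (nearPoint η p S) q p]

end DeloneSet

namespace Hull

variable {Λ : DeloneSet d X} {Λ' : DeloneSet d Y}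

theorem continuousOn_nearPoint {r η : ℝ} (hr : ∀ T : Hull Λ, IsSeparatedBy r T.1.carrier)
    (hη : 2 * η ≤ r) (p : Euc d) :
    ContinuousOn (fun S : Hull Λ => S.1.nearPoint η p)
      {S : Hull Λ | p ∈ thickening η S.1.points} := by
  refine fun T hT => ContinuousAt.continuousWithinAt <| Metric.tendsto_nhds.2 fun ε hε => ?_
  obtain ⟨q, hq, hpq⟩ := mem_thickening_iff.1 hT
  filter_upwards [eventually_mem_thickening_points hq (lt_min hε (sub_pos.2 hpq))] with S hS
  obtain ⟨q', hq', hqq'⟩ := mem_thickening_iff.1 hS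
  have hpq' : dist p q' < η := by
    linarith [dist_triangle p q q', min_le_right ε (η - dist p q)]
  rw [DeloneSet.nearPoint_eq (hr T) hη hq hpq, DeloneSet.nearPoint_eq (hr S) hη hq' hpq',
    dist_comm]
  exact hqq'.trans_le (min_le_left _ _)

/-! ### The canonical transversal -/

/-- The canonical transversal: the elements of the hull that have a point at the origin. -/
def transversal (Λ : DeloneSet d X) : Set (Hull Λ) := {T | 0 ∈ T.1.points}

theorem sub_mem_transversal {T : Hull Λ} {x : Euc d} :
    T - x ∈ transversal Λ ↔ x ∈ T.1.points :=
  DeloneSet.mem_points_sub.trans (by rw [zero_add])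

theorem isClosed_transversal : IsClosed (transversal Λ) := by
  refine isClosed_iff_frequently.2 fun T hT => ?_
  change (0 : Euc d) ∈ T.1.points
  rw [← T.1.isClosed_points.closure_eq, Metric.mem_closure_iff]
  intro ε hε
  obtain ⟨S, ⟨p, hp, hp0⟩, hS⟩ := (hT.and_eventually
    (mem_nhds_right T (patch_subset_thickening_mem_uniformity 1 hε))).exists
  obtain ⟨q, hq, hpq⟩ := mem_thickening_iff.1 (hS ⟨hp, by simp [hp0]⟩)
  exact ⟨q.1, ⟨q, hq, rfl⟩, hp0 ▸ (le_max_left _ _).trans_lt hpq⟩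

theorem mem_closure_image_sub_points {T : Hull Λ} (hT : T ∈ transversal Λ) :
    T.1 ∈ closure ((fun x => Λ - x) '' Λ.points) := by
  refine UniformSpace.mem_closure_iff_ball.2 fun {V} hV => ?_
  obtain ⟨W, hW, hWV⟩ := comp_mem_uniformity_sets hV
  obtain ⟨ε, hε, hεW⟩ := DeloneSet.hasBasis_uniformity.mem_iff.1 hW
  obtain ⟨o, ho, ho0⟩ := hT
  obtain ⟨_, ⟨x, rfl⟩, hxW : (T.1, Λ - x) ∈ W, hxo⟩ :=
    ((mem_closure_iff_frequently.1 T.2).and_eventually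
      ((eventually_mem_set.2 (mem_nhds_left T.1 hW)).and
        (DeloneSet.eventually_mem_thickening ho hε))).exists
  obtain ⟨q, hq, hoq⟩ := mem_thickening_iff.1 hxo
  have hq0 : ‖(0 : Euc d) - q.1‖ < ε := by
    rw [← dist_eq_norm, ← ho0]
    exact (le_max_left _ _).trans_lt hoq
  refine ⟨Λ - (x + q.1), hWV ⟨Λ - x, hxW, ?_⟩, ⟨_, ⟨_, hq, add_comm _ _⟩, rfl⟩⟩
  simpa only [DeloneSet.sub_zero, DeloneSet.sub_sub_eq] using
    hεW (DeloneSet.sub_mem_entourage hq0 (Λ - x))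

end Hull

/-! ### Finite local complexity -/

theorem exists_pairwise_le_dist_of_finite {M : Type*} [MetricSpace M] {s : Set M}
    (hs : s.Finite) : ∃ ε > 0, s.Pairwise fun p q => ε ≤ dist p q := by
  have h : ∀ᶠ ε in 𝓝[>] (0 : ℝ), ∀ z ∈ s.offDiag, ε ≤ dist z.1 z.2 :=
    hs.offDiag.eventually_all.2 fun z hz =>
      mem_of_superset (Ioc_mem_nhdsGT (dist_pos.2 hz.2.2)) fun _ => And.right
  obtain ⟨ε, hsep, hε⟩ := (h.and self_mem_nhdsWithin).exists
  exact ⟨ε, hε, fun p hp q hq hpq => hsep (p, q) ⟨hp, hq, hpq⟩⟩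

namespace DeloneSet

variable {Λ : DeloneSet d X}

theorem IsFLC.finite_biUnion_patch_sub (hΛ : Λ.IsFLC) (R : ℝ) :
    (⋃ x ∈ Λ.points, (Λ - x).patch R).Finite := by
  obtain ⟨Ps, hPs, hΛPs⟩ := hΛ R
  -- A patch that contains the origin is a translate of `P ∈ Ps` by minus one of the points of `P`.
  have hfin : (⋃ P ∈ {P ∈ Ps | P.Finite},
      Set.image2 (fun p q => (p.1 - q.1, p.2)) P P).Finite :=
    (hPs.subset (Set.sep_subset _ _)).biUnion fun P hP => hP.2.image2 _ hP.2
  refine hfin.subset (Set.iUnion₂_subset ?_)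
  rintro x ⟨o, ho, rfl⟩ p hp
  obtain ⟨P, hP, y, hPy⟩ := hΛPs o.1
  have hPfin : P.Finite := Set.Finite.of_finite_image (hPy ▸ (Λ - o.1).finite_patch R)
    ((add_left_injective y).prodMap Function.injective_id).injOn
  have h0 : ((0 : Euc d), o.2) ∈ (Λ - o.1).patch R :=
    ⟨by simpa only [mem_sub, zero_add] using ho, by simpa using (norm_nonneg _).trans_lt hp.2⟩
  rw [hPy] at hp h0
  obtain ⟨p, hp, rfl⟩ := hp
  obtain ⟨q, hq, hq0⟩ := h0
  refine Set.mem_biUnion (x := P) ⟨hP, hPfin⟩ ⟨p, hp, q, hq, ?_⟩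
  have hqy : q.1 + y = 0 := congrArg Prod.fst hq0
  simp only [eq_neg_of_add_eq_zero_right hqy, sub_eq_add_neg]

theorem IsFLC.finite_biUnion_patch_transversal (hΛ : Λ.IsFLC) (R : ℝ) :
    (⋃ T ∈ Hull.transversal Λ, T.1.patch R).Finite := by
  have hfin := hΛ.finite_biUnion_patch_sub R
  refine hfin.subset (Set.iUnion₂_subset fun T hT p hp => ?_)
  rw [← hfin.isClosed.closure_eq, Metric.mem_closure_iff]
  intro ε hε
  have hδ : 0 < min ε (R - ‖p.1‖) := lt_min hε (sub_pos.2 hp.2)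
  obtain ⟨_, ⟨x, hx, rfl⟩, hxp⟩ :=
    ((mem_closure_iff_frequently.1 (Hull.mem_closure_image_sub_points hT)).and_eventually
      (eventually_mem_thickening hp.1 hδ)).exists
  obtain ⟨q, hq, hpq⟩ := mem_thickening_iff.1 hxp
  refine ⟨q, Set.mem_biUnion hx ⟨hq, ?_⟩, hpq.trans_le (min_le_left _ _)⟩
  have hpq₁ : dist p.1 q.1 < R - ‖p.1‖ :=
    (le_max_left _ _).trans_lt (hpq.trans_le (min_le_right _ _))
  linarith [norm_le_norm_add_norm_sub p.1 q.1, dist_eq_norm p.1 q.1]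

end DeloneSet

namespace Hull

variable {Λ : DeloneSet d X}

theorem patch_eq_mem_uniformity_of_isFLC (hΛ : Λ.IsFLC) (R : ℝ) :
    {z : Hull Λ × Hull Λ | z.1 ∈ transversal Λ → z.2 ∈ transversal Λ →
      z.1.1.patch R = z.2.1.patch R} ∈ 𝓤 (Hull Λ) := by
  have hfin := hΛ.finite_biUnion_patch_transversal (R + 1)
  obtain ⟨ε, hε, hsep⟩ := exists_pairwise_le_dist_of_finite hfin
  have key (S T : Hull Λ) (hS : S ∈ transversal Λ) (hT : T ∈ transversal Λ)
      (h : S.1.patch R ⊆ thickening (min ε 1) T.1.carrier) : S.1.patch R ⊆ T.1.patch R := by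
    intro p hp
    obtain ⟨q, hq, hpq⟩ := mem_thickening_iff.1 (h hp)
    have hpq₁ : dist p.1 q.1 < 1 := (le_max_left _ _).trans_lt (hpq.trans_le (min_le_right _ _))
    have hqR : ‖q.1‖ < R + 1 := by
      linarith [norm_le_norm_add_norm_sub p.1 q.1, dist_eq_norm p.1 q.1, hp.2]
    obtain rfl : p = q := hsep.eq (Set.mem_biUnion hS ⟨hp.1, hp.2.trans (lt_add_one R)⟩)
      (Set.mem_biUnion hT ⟨hq, hqR⟩) (hpq.trans_le (min_le_left _ _)).not_ge
    exact ⟨hq, hp.2⟩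
  have hU := patch_subset_thickening_mem_uniformity (Λ := Λ) R (lt_min hε one_pos)
  filter_upwards [hU, UniformSpace.symm hU] with z hz hz' h1 h2
  exact (key _ _ h1 h2 hz).antisymm (key _ _ h2 h1 hz')

theorem isTotallyDisconnected_transversal (hΛ : Λ.IsFLC) :
    IsTotallyDisconnected (transversal Λ) := by
  intro t ht hpre S hS T hT
  refine Hull.ext (DeloneSet.eq_of_forall_patch_eq fun R => ?_)
  let _ : TopologicalSpace (Set (Euc d × X)) := ⊥
  have _ : DiscreteTopology (Set (Euc d × X)) := ⟨rfl⟩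
  refine hpre.constant (f := fun S : Hull Λ => S.1.patch R) (fun S hS => ?_) hS hT
  refine (tendsto_const_nhds (x := S.1.patch R)).congr' ?_
  have hU := mem_nhds_left S (patch_eq_mem_uniformity_of_isFLC hΛ R)
  filter_upwards [mem_nhdsWithin_of_mem_nhds hU, self_mem_nhdsWithin] with S' hSS' hS'
  exact hSS' (ht hS) (ht hS')

end Hull

/-! ### The displacement cocycle of a map of hulls -/

namespace Hull

variable {Λ : DeloneSet d X} {Λ' : DeloneSet d Y}

theorem isTotallyDisconnected_of_countable {A : Set (Hull Λ)} (hA : A.Countable) :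
    IsTotallyDisconnected A :=
  letI := TopologicalSpace.metrizableSpaceMetric (Hull Λ)
  hA.isTotallyDisconnected

/-- The map `g` carries small translations to small translations, uniformly on the hull. -/
def PreservesSmallTranslations (g : Hull Λ → Hull Λ') : Prop :=
  ∀ ε > 0, ∃ δ > 0, ∀ (T : Hull Λ) (x : Euc d), ‖x‖ < δ →
    ∃ y : Euc d, ‖y‖ < ε ∧ g (T - x) = g T - y

/-- The part of the transversal of the target that is met by the orbits through the image under `g`
of the orbit of `T`. -/
def transversalTrace (g : Hull Λ → Hull Λ') (T : Hull Λ) : Set (Hull Λ') :=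
  {S ∈ transversal Λ' | ∃ x y : Euc d, S = g (T - x) - y}

theorem sub_nearPoint_eq_of_isPreconnected {g : Hull Λ → Hull Λ'} (hg : Continuous g)
    {r η : ℝ} (hr : ∀ S : Hull Λ', IsSeparatedBy r S.1.carrier) (hη : 2 * η ≤ r) {T : Hull Λ}
    (hT : IsTotallyDisconnected (transversalTrace g T)) {B : Set (Euc d)} (hB : IsPreconnected B)
    {p : Euc d} (hp : ∀ y ∈ B, p ∈ thickening η (g (T - y)).1.points) {x y : Euc d} (hx : x ∈ B)
    (hy : y ∈ B) : g (T - x) - (g (T - x)).1.nearPoint η p =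
      g (T - y) - (g (T - y)).1.nearPoint η p := by
  have hgT : Continuous fun y : Euc d => g (T - y) := by fun_prop
  refine hT ((fun y => g (T - y) - (g (T - y)).1.nearPoint η p) '' B) ?_ (hB.image _ ?_)
    ⟨x, hx, rfl⟩ ⟨y, hy, rfl⟩
  · rintro _ ⟨y, hy, rfl⟩
    exact ⟨sub_mem_transversal.2 (DeloneSet.nearPoint_spec (hp y hy)).1, y, _, rfl⟩
  · exact continuousOn_sub hgT.continuousOn
      ((continuousOn_nearPoint hr hη p).comp hgT.continuousOn hp)

/-- Follow the point of `g (T - y)` nearest to a fixed point of `g T` as `y` shrinks to `0`: moving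
it to the origin gives a continuous path in a totally disconnected set. -/
theorem preservesSmallTranslations [CompactSpace X] [CompactSpace Y] {g : Hull Λ → Hull Λ'}
    (hg : Continuous g) (htd : ∀ T, IsTotallyDisconnected (transversalTrace g T)) :
    PreservesSmallTranslations g := by
  intro ε hε
  obtain ⟨r, hr, hsep⟩ := exists_isSeparatedBy Λ'
  obtain ⟨R, -, hcov⟩ := exists_isCoveringBy Λ'
  have hη : 0 < min ε (r / 2) := by positivity
  have hηr : 2 * min ε (r / 2) ≤ r := by linarith [min_le_right ε (r / 2)]
  obtain ⟨δ, hδ, hgδ⟩ := exists_forall_sub_mem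
    (CompactSpace.uniformContinuous_of_continuous hg
      (patch_subset_thickening_mem_uniformity (R + 1) hη))
  refine ⟨δ, hδ, fun T x hx => ?_⟩
  obtain ⟨p, hp, hpR⟩ := hcov (g T) 0
  rw [dist_zero_right] at hpR
  have hnear : ∀ y ∈ ball (0 : Euc d) δ,
      p.1 ∈ thickening (min ε (r / 2)) (g (T - y)).1.points := by
    intro y hy
    have hsub : (g (T - (0 : Euc d))).1.patch (R + 1) ⊆
        thickening (min ε (r / 2)) (g (T - y)).1.carrier :=
      hgδ T 0 y (by simpa using hy)
    rw [Hull.sub_zero] at hsub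
    obtain ⟨q, hq, hpq⟩ := mem_thickening_iff.1 (hsub ⟨hp, hpR.trans_lt (lt_add_one R)⟩)
    exact mem_thickening_iff.2 ⟨q.1, ⟨q, hq, rfl⟩, (le_max_left _ _).trans_lt hpq⟩
  have hxδ : x ∈ ball (0 : Euc d) δ := by simpa using hx
  have hconst := sub_nearPoint_eq_of_isPreconnected hg hsep hηr (htd T)
    (convex_ball (0 : Euc d) δ).isPreconnected hnear hxδ (mem_ball_self hδ)
  rw [Hull.sub_zero, (g T).1.nearPoint_eq (hsep _) hηr ⟨p, hp, rfl⟩ (by rwa [dist_self])] at hconst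
  refine ⟨p.1 - (g (T - x)).1.nearPoint (min ε (r / 2)) p.1, ?_, ?_⟩
  · rw [← dist_eq_norm]
    exact (DeloneSet.nearPoint_spec (hnear x hxδ)).2.trans_le (min_le_left _ _)
  · rw [sub_eq_add_neg, ← Hull.sub_sub_eq, ← hconst, Hull.sub_sub_eq, add_neg_cancel,
      Hull.sub_zero]

theorem isTotallyDisconnected_transversalTrace {h : Hull Λ ≃ₜ Hull Λ'}
    (hh : IsOrbitEquivalence h ∨ Λ'.IsFLC) (T : Hull Λ) :
    IsTotallyDisconnected (transversalTrace h T) := by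
  rcases hh with hh | hΛ'
  · -- The trace consists of the translates of `h T` by its countably many points.
    refine isTotallyDisconnected_of_countable
      (((h T).1.countable_points.image fun y => h T - y).mono ?_)
    rintro _ ⟨hS, x, y, rfl⟩
    obtain ⟨z, hz : h T - z = h (T - x)⟩ := (hh T).subset ⟨T - x, ⟨x, rfl⟩, rfl⟩
    rw [← hz, Hull.sub_sub_eq] at hS ⊢
    exact ⟨_, sub_mem_transversal.1 hS, rfl⟩
  · exact fun t ht => isTotallyDisconnected_transversal hΛ' t (ht.trans (Set.sep_subset _ _))

theorem isOrbitEquivalence_symm {h : Hull Λ ≃ₜ Hull Λ'} (hh : IsOrbitEquivalence h) :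
    IsOrbitEquivalence h.symm := by
  intro T
  rw [Homeomorph.image_symm, ← h.preimage_image (Set.range _), hh, h.apply_symm_apply]

theorem PreservesSmallTranslations.exists_norm_le {g : Hull Λ → Hull Λ'}
    (hg : PreservesSmallTranslations g) (M : ℝ) : ∃ K : ℝ, ∀ (T : Hull Λ) (x : Euc d), ‖x‖ ≤ M →
      ∃ y : Euc d, ‖y‖ ≤ K ∧ g (T - x) = g T - y := by
  obtain ⟨δ, hδ, hgδ⟩ := hg 1 one_pos
  have hmul (n : ℕ) (T : Hull Λ) (x : Euc d) (hx : ‖x‖ < δ) :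
      ∃ y : Euc d, ‖y‖ ≤ n ∧ g (T - n • x) = g T - y := by
    induction n with
    | zero => exact ⟨0, by simp⟩
    | succ n ih =>
      obtain ⟨y, hy, hgy⟩ := ih
      obtain ⟨z, hz, hgz⟩ := hgδ (T - n • x) x hx
      refine ⟨y + z, ?_, ?_⟩
      · push_cast
        exact (norm_add_le y z).trans (by linarith)
      · rw [succ_nsmul, ← Hull.sub_sub_eq, hgz, hgy, Hull.sub_sub_eq]
  obtain ⟨n, hn⟩ := exists_nat_gt (max (M / δ) 0)
  have hn0 : (0 : ℝ) < n := (le_max_right _ _).trans_lt hn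
  have hMn : M < δ * n := (div_lt_iff₀' hδ).1 ((le_max_left _ _).trans_lt hn)
  refine ⟨n, fun T x hx => ?_⟩
  obtain ⟨y, hy, hgy⟩ := hmul n T ((n : ℝ)⁻¹ • x) (by
    rw [norm_smul, norm_inv, Real.norm_natCast, inv_mul_lt_iff₀' hn0]
    exact hx.trans_lt hMn)
  rw [← Nat.cast_smul_eq_nsmul ℝ, smul_inv_smul₀ hn0.ne'] at hgy
  exact ⟨y, hy, hgy⟩

theorem sub_left_cancel (haper : IsAperiodic Λ) {T : Hull Λ} {x y : Euc d} (h : T - x = T - y) :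
    x = y := by
  refine (sub_eq_zero.1 (haper (T - x) (y - x) ?_)).symm
  rw [Hull.sub_sub_eq, add_sub_cancel, h]

/-- A displacement between two continuous maps is continuous as soon as it is locally bounded: by
aperiodicity, it has only one possible cluster value at each point. -/
theorem continuous_of_eq_sub (haper : IsAperiodic Λ) {Z : Type*} [TopologicalSpace Z]
    {f g : Z → Hull Λ} {a : Z → Euc d} (hf : Continuous f) (hg : Continuous g)
    (ha : ∀ z, f z = g z - a z) (hbdd : ∀ z, ∃ K : ℝ, ∀ᶠ w in 𝓝 z, ‖a w‖ ≤ K) :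
    Continuous a := by
  refine continuous_iff_continuousAt.2 fun z => ?_
  obtain ⟨K, hK⟩ := hbdd z
  refine (isCompact_closedBall (0 : Euc d) K).tendsto_nhds_of_unique_mapClusterPt
    (hK.mono fun w hw => mem_closedBall_zero_iff.2 hw) fun y _ hy => ?_
  obtain ⟨U, hU, hUy⟩ := mapClusterPt_iff_ultrafilter.1 hy
  have hUf : Tendsto (fun w => g w - a w) U (𝓝 (g z - y)) :=
    ((continuous_sub continuous_fst continuous_snd).tendsto (g z, y)).comp
      (((hg.tendsto z).mono_left hU).prodMk_nhds hUy)
  simp only [← ha] at hUf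
  exact sub_left_cancel haper
    ((tendsto_nhds_unique hUf ((hf.tendsto z).mono_left hU)).trans (ha z))

theorem PreservesSmallTranslations.exists_isCocycleOf (haper' : IsAperiodic Λ')
    {g : Hull Λ → Hull Λ'} (hg : PreservesSmallTranslations g) (hc : Continuous g) :
    ∃ α : weakCocycles Λ, IsCocycleOf g α.1 := by
  choose K hK using hg.exists_norm_le
  choose a _ ha using fun z : Hull Λ × Euc d => hK ‖z.2‖ z.1 z.2 le_rfl
  have hbdd (M : ℝ) (z : Hull Λ × Euc d) (hz : ‖z.2‖ ≤ M) : ‖a z‖ ≤ K M := by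
    obtain ⟨y, hy, hgy⟩ := hK M z.1 z.2 hz
    rwa [sub_left_cancel haper' ((ha z).symm.trans hgy)]
  have hcont : Continuous a := by
    refine continuous_of_eq_sub haper' (f := fun z => g (z.1 - z.2)) (g := fun z => g z.1)
      (by fun_prop) (by fun_prop) ha fun z => ⟨K (‖z.2‖ + 1), ?_⟩
    filter_upwards [(continuous_snd.norm.tendsto z).eventually (gt_mem_nhds (lt_add_one ‖z.2‖))]
      with w hw using hbdd _ w hw.le
  refine ⟨⟨⟨a, hcont⟩, fun T x y => sub_left_cancel haper' (T := g T) ?_⟩, fun T x => ha (T, x)⟩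
  simp only [ContinuousMap.coe_mk]
  rw [← Hull.sub_sub_eq, ← ha (T, x), ← ha (T - x, y), ← ha (T, x + y), Hull.sub_sub_eq]

theorem isCocycleOf_unique (haper' : IsAperiodic Λ') {g : Hull Λ → Hull Λ'}
    {α β : C(Hull Λ × Euc d, Euc d)} (hα : IsCocycleOf g α) (hβ : IsCocycleOf g β) : α = β :=
  ContinuousMap.ext fun ⟨T, x⟩ => sub_left_cancel haper' ((hα T x).symm.trans (hβ T x))

theorem exists_isCocycleOf_homeomorph [CompactSpace X] [CompactSpace Y] (haper' : IsAperiodic Λ')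
    {h : Hull Λ ≃ₜ Hull Λ'} (hh : IsOrbitEquivalence h ∨ Λ'.IsFLC) :
    ∃ α : weakCocycles Λ, IsCocycleOf h α.1 :=
  (preservesSmallTranslations h.continuous
    (isTotallyDisconnected_transversalTrace hh)).exists_isCocycleOf haper' h.continuous

/-! ### Cocycles and coboundaries -/

section Cocycle

variable {α : C(Hull Λ × Euc d, Euc d)}

theorem cocycle_zero (hα : α ∈ weakCocycles Λ) (T : Hull Λ) : α (T, 0) = 0 := by
  simpa using hα T 0 0

theorem cocycle_sub (hα : α ∈ weakCocycles Λ) (T : Hull Λ) (x y : Euc d) :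
    α (T - x, y) = α (T, x + y) - α (T, x) :=
  eq_sub_of_add_eq' (hα T x y)

theorem norm_cocycle_nsmul_le (hα : α ∈ weakCocycles Λ) {K : ℝ} {x : Euc d}
    (hK : ∀ T, ‖α (T, x)‖ ≤ K) (n : ℕ) (T : Hull Λ) : ‖α (T, n • x)‖ ≤ n * K := by
  induction n with
  | zero => simp [cocycle_zero hα]
  | succ n ih =>
    rw [succ_nsmul, ← hα T]
    refine (norm_add_le _ _).trans ?_
    push_cast
    linarith [hK (T - n • x)]

theorem exists_forall_norm_le [CompactSpace X] (α : C(Hull Λ × Euc d, Euc d)) (M : ℝ) :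
    ∃ K, ∀ (T : Hull Λ) (x : Euc d), ‖x‖ ≤ M → ‖α (T, x)‖ ≤ K := by
  obtain ⟨K, hK⟩ := (isCompact_univ.prod
    (isCompact_closedBall (0 : Euc d) M)).exists_bound_of_continuousOn α.continuous.continuousOn
  exact ⟨K, fun T x hx => hK (T, x) ⟨trivial, by simpa using hx⟩⟩

theorem exists_norm_cocycle_le [CompactSpace X] (hα : α ∈ weakCocycles Λ) :
    ∃ K, ∀ (T : Hull Λ) (x : Euc d), ‖α (T, x)‖ ≤ K * (‖x‖ + 1) := by
  obtain ⟨K, hK⟩ := exists_forall_norm_le α 1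
  refine ⟨K, fun T x => ?_⟩
  have hK0 : 0 ≤ K := (norm_nonneg _).trans (hK T 0 (by simp))
  have hn : (0 : ℝ) < (⌊‖x‖⌋₊ + 1 : ℕ) := by positivity
  have hx : ‖((⌊‖x‖⌋₊ + 1 : ℕ) : ℝ)⁻¹ • x‖ ≤ 1 := by
    rw [norm_smul, norm_inv, Real.norm_natCast, inv_mul_le_one₀ hn]
    exact_mod_cast (Nat.lt_floor_add_one ‖x‖).le
  have hle := norm_cocycle_nsmul_le hα (fun S => hK S _ hx) (⌊‖x‖⌋₊ + 1) T
  rw [← Nat.cast_smul_eq_nsmul ℝ, smul_inv_smul₀ hn.ne'] at hle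
  calc ‖α (T, x)‖ ≤ (⌊‖x‖⌋₊ + 1 : ℕ) * K := hle
    _ ≤ (‖x‖ + 1) * K := by
      push_cast
      gcongr
      exact Nat.floor_le (norm_nonneg x)
    _ = K * (‖x‖ + 1) := mul_comm _ _

end Cocycle

/-- The cocycles of `h` and of its inverse are inverse to each other along the orbits, and the
latter grows at most linearly. -/
theorem exists_norm_le_cocycle [CompactSpace Y] (haper : IsAperiodic Λ) {h : Hull Λ ≃ₜ Hull Λ'}
    {α : C(Hull Λ × Euc d, Euc d)} (hα : IsCocycleOf h α) {β : C(Hull Λ' × Euc d, Euc d)}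
    (hβc : β ∈ weakCocycles Λ') (hβ : IsCocycleOf h.symm β) :
    ∃ K : ℝ, ∀ (T : Hull Λ) (x : Euc d), ‖x‖ ≤ K * (‖α (T, x)‖ + 1) := by
  obtain ⟨K, hK⟩ := exists_norm_cocycle_le hβc
  refine ⟨K, fun T x => ?_⟩
  have hinv : β (h T, α (T, x)) = x := by
    refine sub_left_cancel haper (T := T) ?_
    have hsub := hβ (h T) (α (T, x))
    rw [← hα T x, h.symm_apply_apply, h.symm_apply_apply] at hsub
    exact hsub.symm
  simpa only [hinv] using hK (h T) (α (T, x))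

/-- The coboundary `δs`, as a weak cocycle. -/
def coboundary (s : C(Hull Λ, Euc d)) : weakCocycles Λ where
  val := ⟨fun z => s (z.1 - z.2) - s z.1, by fun_prop⟩
  property T x y := by
    simp only [ContinuousMap.coe_mk, Hull.sub_sub_eq]
    abel

@[simp]
theorem coboundary_apply (s : C(Hull Λ, Euc d)) (T : Hull Λ) (v : Euc d) :
    (coboundary s).1 (T, v) = s (T - v) - s T := rfl

theorem weakH1_mk_eq_mk_iff {α β : weakCocycles Λ} :
    (QuotientAddGroup.mk β : WeakH1 Λ) = QuotientAddGroup.mk α ↔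
      ∃ s : C(Hull Λ, Euc d), β = α + coboundary s := by
  rw [eq_comm, QuotientAddGroup.eq]
  refine exists_congr fun s => ⟨fun h => ?_, fun h T v => ?_⟩
  · refine Subtype.ext (ContinuousMap.ext fun ⟨T, v⟩ => ?_)
    simpa [neg_add_eq_iff_eq_add] using h T v
  · simp [h]

end Hull

/-! ### Smoothing a cocycle along the leaves -/

section Convolution

open scoped Convolution

variable {Z E F G : Type*} [TopologicalSpace Z] [FirstCountableTopology Z] [LocallyCompactSpace Z]
  [NormedAddCommGroup E] [NormedSpace ℝ E] [NormedAddCommGroup F] [NormedSpace ℝ F]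
  [NormedAddCommGroup G] [NormedSpace ℝ G]

theorem continuous_convolution_of_param {a : Z → Euc d → E} (ha : Continuous a.uncurry)
    (L : E →L[ℝ] F →L[ℝ] G) {g : Euc d → F} (hg : Continuous g) (hcs : HasCompactSupport g)
    (x : Euc d) : Continuous fun z => (a z ⋆[L, volume] g) x := by
  have hK : IsCompact ((Homeomorph.subLeft x) ⁻¹' tsupport g) :=
    (Homeomorph.isCompact_preimage _).2 hcs
  have hset : (fun z => (a z ⋆[L, volume] g) x) =
      fun z => ∫ t in (Homeomorph.subLeft x) ⁻¹' tsupport g, L (a z t) (g (x - t)) := by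
    funext z
    rw [convolution_def, setIntegral_eq_integral_of_forall_compl_eq_zero]
    intro t ht
    rw [image_eq_zero_of_notMem_tsupport (f := g) (x := x - t) ht, map_zero]
  rw [hset]
  refine continuous_parametric_integral_of_continuous ?_ hK
  exact (L.continuous.comp ha).clm_apply (by fun_prop)

theorem continuous_iteratedFDeriv_convolution_of_param {a : Z → Euc d → E}
    (ha : Continuous a.uncurry) (L : E →L[ℝ] F →L[ℝ] G) {g : Euc d → F} (hg : ContDiff ℝ ∞ g)
    (hcs : HasCompactSupport g) (n : ℕ) (x : Euc d) :
    Continuous fun z => iteratedFDeriv ℝ n (a z ⋆[L, volume] g) x := by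
  induction n generalizing F G with
  | zero =>
    simp only [iteratedFDeriv_zero_eq_comp, Function.comp_apply]
    exact (LinearIsometryEquiv.continuous _).comp
      (continuous_convolution_of_param ha L hg.continuous hcs x)
  | succ n ih =>
    have hfderiv (z : Z) : fderiv ℝ (a z ⋆[L, volume] g) =
        a z ⋆[L.precompR (Euc d), volume] fderiv ℝ g := by
      have hz : Continuous (a z) := ha.comp (Continuous.prodMk_right z)
      exact funext fun y => (hcs.hasFDerivAt_convolution_right L hz.locallyIntegrable
        (hg.of_le (by exact_mod_cast le_top)) y).fderiv
    simp only [iteratedFDeriv_succ_eq_comp_right, Function.comp_apply, hfderiv]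
    exact (LinearIsometryEquiv.continuous _).comp
      (ih (L.precompR (Euc d)) (hg.fderiv_right (by simp)) (hcs.fderiv ℝ))

end Convolution

namespace Hull

open scoped Convolution

variable {Λ : DeloneSet d X}

/-- Pattern equivariance of `α (·, x)` with a radius that is locally uniform in `x`. -/
def IsUniformlyPE (α : C(Hull Λ × Euc d, Euc d)) : Prop :=
  ∀ M : ℝ, ∃ R > 0, ∀ T T' : Hull Λ, T.1.patch R = T'.1.patch R →
    ∀ x : Euc d, ‖x‖ ≤ M → α (T, x) = α (T', x)

theorem continuous_leaf (α : C(Hull Λ × Euc d, Euc d)) (T : Hull Λ) :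
    Continuous fun t => α (T, t) :=
  α.continuous.comp (Continuous.prodMk_right T)

section Mollification

variable (φ : ContDiffBump (0 : Euc d)) (α : C(Hull Λ × Euc d, Euc d))

/-- The convolution of `α (T, ·)` with the bump function `φ`, normalized to have integral `1`. -/
def mollify (T : Hull Λ) : Euc d → Euc d :=
  (fun t => α (T, t)) ⋆[(ContinuousLinearMap.lsmul ℝ ℝ).flip, volume] φ.normed volume

theorem mollify_apply (T : Hull Λ) (x : Euc d) :
    mollify φ α T x = ∫ t, φ.normed volume (x - t) • α (T, t) := rfl

theorem contDiff_mollify (T : Hull Λ) : ContDiff ℝ ∞ (mollify φ α T) :=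
  φ.hasCompactSupport_normed.contDiff_convolution_right _ (continuous_leaf α T).locallyIntegrable
    φ.contDiff_normed

theorem fderiv_mollify (T : Hull Λ) : fderiv ℝ (mollify φ α T) =
    (fun t => α (T, t)) ⋆[(ContinuousLinearMap.lsmul ℝ ℝ).flip.precompR (Euc d), volume]
      fderiv ℝ (φ.normed volume) :=
  funext fun x => (φ.hasCompactSupport_normed.hasFDerivAt_convolution_right _
    (continuous_leaf α T).locallyIntegrable φ.contDiff_normed x).fderiv

theorem normed_smul_congr_of_lt {f g : Euc d → Euc d} {x t : Euc d}
    (h : ‖t‖ < ‖x‖ + φ.rOut → f t = g t) :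
    φ.normed volume (x - t) • f t = φ.normed volume (x - t) • g t := by
  rcases lt_or_ge ‖t‖ (‖x‖ + φ.rOut) with ht | ht
  · rw [h ht]
  · have hxt : x - t ∉ Function.support (φ.normed volume) := by
      rw [φ.support_normed_eq, mem_ball_zero_iff, not_lt]
      linarith [norm_le_norm_add_norm_sub x t]
    rw [Function.notMem_support.1 hxt, zero_smul, zero_smul]

variable {α} in
theorem IsUniformlyPE.mollify_eq (hα : IsUniformlyPE α) (M : ℝ) :
    ∃ R > 0, ∀ T T' : Hull Λ, T.1.patch R = T'.1.patch R →
      ∀ x : Euc d, ‖x‖ ≤ M → mollify φ α T x = mollify φ α T' x := by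
  obtain ⟨R, hR, h⟩ := hα (M + φ.rOut)
  refine ⟨R, hR, fun T T' hT x hx => integral_congr_ae (Eventually.of_forall fun t => ?_)⟩
  exact normed_smul_congr_of_lt φ (f := fun t => α (T, t)) (g := fun t => α (T', t))
    fun ht => h T T' hT t (by linarith)

variable {α} in
theorem mollify_eq_add (hα : α ∈ weakCocycles Λ) (T : Hull Λ) (x : Euc d) :
    mollify φ α T x = α (T, x) + mollify φ α (T - x) 0 := by
  have hint : Integrable fun t => φ.normed volume (x - t) • α (T, t) := by
    refine Continuous.integrable_of_hasCompactSupport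
      ((φ.continuous_normed.comp (by fun_prop)).smul (continuous_leaf α T)) ?_
    exact (φ.hasCompactSupport_normed.comp_homeomorph (Homeomorph.subLeft x)).smul_right
  have hint' : Integrable fun t => φ.normed volume (0 - t) • α (T, x) :=
    (φ.integrable_normed.comp_sub_left 0).smul_const _
  rw [← sub_eq_iff_eq_add']
  symm
  calc mollify φ α (T - x) 0
      = ∫ t, (φ.normed volume (x - (x + t)) • α (T, x + t) -
          φ.normed volume (0 - t) • α (T, x)) := by
        simp only [mollify_apply, cocycle_sub hα, smul_sub, sub_add_cancel_left, zero_sub]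
    _ = mollify φ α T x - α (T, x) := by
        rw [integral_sub (hint.comp_add_left x) hint',
          integral_add_left_eq_self (fun t => φ.normed volume (x - t) • α (T, t)) x,
          integral_smul_const, integral_sub_left_eq_self (φ.normed volume) volume 0,
          φ.integral_normed, one_smul, mollify_apply]

variable {α} in
theorem fderiv_mollify_sub (hα : α ∈ weakCocycles Λ) (T : Hull Λ) (x : Euc d) :
    fderiv ℝ (mollify φ α (T - x)) 0 = fderiv ℝ (mollify φ α T) x := by
  have hleaf : mollify φ α (T - x) = fun v => mollify φ α T (x + v) - α (T, x) := by
    funext v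
    rw [mollify_eq_add φ hα (T - x), mollify_eq_add φ hα T, cocycle_sub hα, Hull.sub_sub_eq]
    abel
  rw [hleaf, fderiv_sub_const, fderiv_comp_add_left, add_zero]

end Mollification

section MollifiedForm

variable [CompactSpace X] (φ : ContDiffBump (0 : Euc d))

/-- The function `s` for which `mollifiedForm φ α` has the primitive `α + δs`. -/
def mollificationTransfer (α : C(Hull Λ × Euc d, Euc d)) : C(Hull Λ, Euc d) where
  toFun T := mollify φ α T 0
  continuous_toFun := continuous_convolution_of_param (a := fun T t => α (T, t)) α.continuous _
    φ.continuous_normed φ.hasCompactSupport_normed 0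

/-- The closed form whose restriction to the leaf of `T` is the differential of the mollification
of `α (T, ·)`. -/
def mollifiedForm (α : weakCocycles Λ) : PEForm Λ where
  toFun T := fderiv ℝ (mollify φ α.1 T) 0
  smooth T := by
    simp only [fderiv_mollify_sub φ α.2]
    exact (contDiff_mollify φ α.1 T).fderiv_right (by simp)
  equivariant n := by
    simp only [fderiv_mollify_sub φ α.2, fderiv_mollify]
    exact continuous_iteratedFDeriv_convolution_of_param (a := fun T t => α.1 (T, t))
      α.1.continuous _ (φ.contDiff_normed.fderiv_right (m := ∞) (n := ∞) (by simp))
      (φ.hasCompactSupport_normed.fderiv ℝ) n 0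
  closed T x u v := by
    simp only [fderiv_mollify_sub φ α.2]
    refine (contDiff_mollify φ α.1 T).contDiffAt.isSymmSndFDerivAt ?_ u v
    rw [minSmoothness_of_isRCLikeNormedField]
    exact WithTop.coe_le_coe.2 le_top

theorem hasPrimitive_mollifiedForm (α : weakCocycles Λ) :
    (mollifiedForm φ α).HasPrimitive (α + coboundary (mollificationTransfer φ α.1)).1 := by
  intro T x
  have hleaf : (fun v => (α + coboundary (mollificationTransfer φ α.1)).1 (T, v)) =
      fun v => mollify φ α.1 T v - mollify φ α.1 T 0 := by
    funext v
    rw [mollify_eq_add φ α.2, add_sub_assoc]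
    rfl
  have hdiff : DifferentiableAt ℝ (mollify φ α.1 T) x :=
    (contDiff_mollify φ α.1 T).differentiable (by simp) x
  rw [hleaf]
  change HasFDerivAt _ (fderiv ℝ (mollify φ α.1 (T - x)) 0) x
  rw [fderiv_mollify_sub φ α.2]
  exact hdiff.hasFDerivAt.sub_const _

theorem IsUniformlyPE.isStronglyPE_mollificationTransfer {α : C(Hull Λ × Euc d, Euc d)}
    (hα : IsUniformlyPE α) : IsStronglyPE (mollificationTransfer φ α) := by
  obtain ⟨R, hR, h⟩ := hα.mollify_eq φ 0
  exact ⟨R, hR, fun T T' hT => h T T' hT 0 norm_zero.le⟩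

theorem IsUniformlyPE.isStronglyPE_mollifiedForm {α : weakCocycles Λ} (hα : IsUniformlyPE α.1) :
    IsStronglyPE (mollifiedForm φ α).toFun := by
  obtain ⟨R, hR, h⟩ := hα.mollify_eq φ 1
  refine ⟨R, hR, fun T T' hT => EventuallyEq.fderiv_eq ?_⟩
  filter_upwards [ball_mem_nhds (0 : Euc d) one_pos] with x hx
  exact h T T' hT x (mem_ball_zero_iff.1 hx).le

theorem exists_representsWeak (c : WeakH1 Λ) : ∃ η : PEForm Λ, η.RepresentsWeak c := by
  obtain ⟨α, rfl⟩ := QuotientAddGroup.mk_surjective c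
  exact ⟨mollifiedForm default α, _, hasPrimitive_mollifiedForm default α,
    weakH1_mk_eq_mk_iff.2 ⟨_, rfl⟩⟩

end MollifiedForm

end Hull

/-! ### Averages of cocycles over ergodic actions -/

section ErgodicAction

variable {G Z E : Type*}

section Measurable

variable [MeasurableSpace Z] {μ : Measure Z}

theorem exists_ae_eq_const_of_forall_vadd_ae_eq (G : Type*) [VAdd G Z] [ErgodicVAdd G Z μ]
    [MeasurableSpace E] [Nonempty E] [MeasurableSpace.CountablySeparated E] {f : Z → E}
    (hf : NullMeasurable f μ) (hinv : ∀ g : G, (fun z => f (g +ᵥ z)) =ᵐ[μ] f) :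
    ∃ c, f =ᵐ[μ] Function.const Z c := by
  refine exists_eventuallyEq_const_of_forall_separating MeasurableSet fun U hU => ?_
  refine eventuallyConst_set.1 (aeconst_of_forall_preimage_vadd_ae_eq G (hf hU) fun g => ?_)
  filter_upwards [hinv g] with z hz
  exact congrArg (· ∈ U) hz

theorem norm_integral_le_norm_Lp [NormedAddCommGroup E] [NormedSpace ℝ E] [IsProbabilityMeasure μ]
    {p : ENNReal} [hp : Fact (1 ≤ p)] (f : Lp E p μ) : ‖∫ z, f z ∂μ‖ ≤ ‖f‖ := by
  rw [Lp.norm_def, ← toReal_enorm]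
  refine ENNReal.toReal_mono (Lp.eLpNorm_ne_top f) ?_
  calc ‖∫ z, f z ∂μ‖ₑ ≤ eLpNorm f 1 μ := by
        rw [eLpNorm_one_eq_lintegral_enorm]
        exact enorm_integral_le_lintegral_enorm _
    _ ≤ eLpNorm f p μ := eLpNorm_le_eLpNorm_of_exponent_le hp.out (Lp.aestronglyMeasurable f)

theorem continuous_integral_Lp [NormedAddCommGroup E] [NormedSpace ℝ E] [IsProbabilityMeasure μ]
    {p : ENNReal} [hp : Fact (1 ≤ p)] : Continuous fun f : Lp E p μ => ∫ z, f z ∂μ := by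
  have hint (f : Lp E p μ) : Integrable f μ := (Lp.memLp f).integrable hp.out
  refine (LipschitzWith.of_dist_le_mul (K := 1) fun f g => ?_).continuous
  rw [NNReal.coe_one, one_mul, dist_eq_norm, dist_eq_norm, ← integral_sub (hint f) (hint g)]
  refine le_of_eq_of_le (congrArg norm (integral_congr_ae ?_)) (norm_integral_le_norm_Lp (f - g))
  exact (Lp.coeFn_sub f g).symm

variable (E μ) in
/-- The Koopman operator `f ↦ f (g +ᵥ ·)` of the translation by `g`. -/
def koopman [NormedAddCommGroup E] [NormedSpace ℝ E] [VAdd G Z] [MeasurableConstVAdd G Z]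
    [VAddInvariantMeasure G Z μ] (g : G) : Lp E 2 μ →ₗᵢ[ℝ] Lp E 2 μ :=
  Lp.compMeasurePreservingₗᵢ ℝ (g +ᵥ ·) (measurePreserving_vadd g μ)

theorem coeFn_koopman [NormedAddCommGroup E] [NormedSpace ℝ E] [VAdd G Z]
    [MeasurableConstVAdd G Z] [VAddInvariantMeasure G Z μ] (g : G) (f : Lp E 2 μ) :
    koopman E μ g f =ᵐ[μ] fun z => f (g +ᵥ z) :=
  Lp.coeFn_compMeasurePreserving f (measurePreserving_vadd g μ)

theorem eq_const_of_forall_koopman_eq [NormedAddCommGroup E] [NormedSpace ℝ E]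
    [SecondCountableTopology E] [CompleteSpace E] [IsProbabilityMeasure μ] [VAdd G Z]
    [MeasurableConstVAdd G Z] [ErgodicVAdd G Z μ] {f : Lp E 2 μ}
    (hf : ∀ g : G, koopman E μ g f = f) : f = Lp.const 2 μ (∫ z, f z ∂μ) := by
  borelize E
  obtain ⟨c, hc⟩ := exists_ae_eq_const_of_forall_vadd_ae_eq G
    (Lp.stronglyMeasurable f).measurable.nullMeasurable fun g => by
      simpa only [hf g] using (coeFn_koopman g f).symm
  have hint : ∫ z, f z ∂μ = c := by simp [integral_congr_ae hc]
  rw [hint]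
  exact Lp.ext (hc.trans (Lp.coeFn_const 2 μ c).symm)

end Measurable

variable [TopologicalSpace Z]

/-- The translation by `g`, as a continuous map. -/
def translation (Z : Type*) [TopologicalSpace Z] [VAdd G Z] [ContinuousConstVAdd G Z]
    (g : G) : C(Z, Z) :=
  ⟨(g +ᵥ ·), continuous_const_vadd g⟩

/-- Cocycles over an action of `G` on `Z`, written as families of continuous functions on `Z`. -/
def IsAdditiveCocycle [Add G] [VAdd G Z] [ContinuousConstVAdd G Z] [NormedAddCommGroup E]
    (a : G → C(Z, E)) : Prop :=
  ∀ g h, a (g + h) = a g + (a h).comp (translation Z g)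

theorem IsAdditiveCocycle.map_zero [AddMonoid G] [AddAction G Z] [ContinuousConstVAdd G Z]
    [NormedAddCommGroup E] {a : G → C(Z, E)} (ha : IsAdditiveCocycle a) : a 0 = 0 := by
  ext z
  have := DFunLike.congr_fun (ha 0 0) z
  simpa [translation] using this

theorem integral_comp_translation [MeasurableSpace Z] [BorelSpace Z] {μ : Measure Z} [VAdd G Z]
    [ContinuousConstVAdd G Z] [VAddInvariantMeasure G Z μ] [NormedAddCommGroup E]
    [NormedSpace ℝ E] [SecondCountableTopologyEither Z E] (g : G) (f : C(Z, E)) :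
    ∫ z, f (g +ᵥ z) ∂μ = ∫ z, f z ∂μ := by
  have hg := measurePreserving_vadd g μ
  conv_rhs => rw [← hg.map_eq]
  exact (integral_map hg.measurable.aemeasurable f.continuous.aestronglyMeasurable).symm

variable [CompactSpace Z]

theorem IsAdditiveCocycle.norm_comp_translation_sub_le [AddCommMonoid G] [AddAction G Z]
    [ContinuousConstVAdd G Z] [NormedAddCommGroup E] {a : G → C(Z, E)} (ha : IsAdditiveCocycle a)
    (g h : G) : ‖(a g).comp (translation Z h) - a g‖ ≤ 2 * ‖a h‖ := by
  have heq : (a g).comp (translation Z h) - a g = (a h).comp (translation Z g) - a h := by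
    rw [sub_eq_sub_iff_add_eq_add, add_comm, ← ha, add_comm h, ha, add_comm]
  rw [heq, two_mul]
  refine (norm_sub_le _ _).trans (add_le_add_left ?_ _)
  exact (ContinuousMap.norm_le _ (norm_nonneg _)).2 fun z => (a h).norm_coe_le_norm _

variable [MeasurableSpace Z] [BorelSpace Z] {μ : Measure Z}

theorem integrable_of_continuous [IsFiniteMeasure μ] [NormedAddCommGroup E] {f : Z → E}
    (hf : Continuous f) : Integrable f μ :=
  hf.integrable_of_hasCompactSupport (HasCompactSupport.of_compactSpace f)

theorem le_norm_toLp [IsProbabilityMeasure μ] [NormedAddCommGroup E] [NormedSpace ℝ E]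
    [SecondCountableTopologyEither Z E] {f : C(Z, E)} {c : ℝ} (hc : ∀ z, c ≤ ‖f z‖) :
    c ≤ ‖f.toLp 2 μ ℝ‖ := by
  rcases le_total c 0 with hneg | hpos
  · exact hneg.trans (norm_nonneg _)
  have hconst : ‖Lp.const 2 μ c‖ = c := by
    simp [Lp.norm_const' _ _ _ two_ne_zero ENNReal.ofNat_ne_top, abs_of_nonneg hpos]
  rw [← hconst]
  refine Lp.norm_le_norm_of_ae_le ?_
  filter_upwards [ContinuousMap.coeFn_toLp (p := 2) (𝕜 := ℝ) μ f, Lp.coeFn_const 2 μ c] with z hf h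
  rw [hf, h, Function.const_apply, Real.norm_of_nonneg hpos]
  exact hc z

section Invariant

variable [AddMonoid G] [AddAction G Z] [ContinuousConstVAdd G Z] [VAddInvariantMeasure G Z μ]
  [IsFiniteMeasure μ] [NormedAddCommGroup E] [NormedSpace ℝ E] [SecondCountableTopologyEither Z E]

theorem koopman_toLp (g : G) (f : C(Z, E)) :
    koopman E μ g (f.toLp 2 μ ℝ) = (f.comp (translation Z g)).toLp 2 μ ℝ :=
  Lp.ext <| (coeFn_koopman g _).trans <|
    ((measurePreserving_vadd g μ).quasiMeasurePreserving.ae_eq_comp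
      (ContinuousMap.coeFn_toLp μ f)).trans
      (ContinuousMap.coeFn_toLp μ (f.comp (translation Z g))).symm

theorem koopman_iterate_toLp (g : G) (f : C(Z, E)) (n : ℕ) :
    (koopman E μ g)^[n] (f.toLp 2 μ ℝ) = (f.comp (translation Z (n • g))).toLp 2 μ ℝ := by
  induction n with
  | zero =>
    have h0 : f.comp (translation Z (0 • g)) = f := ContinuousMap.ext fun z => by
      simp [translation]
    rw [h0, Function.iterate_zero, id]
  | succ n ih =>
    have hcomp : (f.comp (translation Z (n • g))).comp (translation Z g) =
        f.comp (translation Z ((n + 1) • g)) := ContinuousMap.ext fun z => by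
      simp [translation, vadd_vadd, succ_nsmul]
    rw [Function.iterate_succ_apply', ih, koopman_toLp, hcomp]

namespace IsAdditiveCocycle

variable {a : G → C(Z, E)}

theorem birkhoffSum_koopman (ha : IsAdditiveCocycle a) (g : G) (n : ℕ) :
    birkhoffSum (koopman E μ g) id n ((a g).toLp 2 μ ℝ) = (a (n • g)).toLp 2 μ ℝ := by
  induction n with
  | zero => simp [ha.map_zero]
  | succ n ih =>
    rw [birkhoffSum_succ, ih, id, koopman_iterate_toLp, ← _root_.map_add, succ_nsmul, ha]

variable (μ) in
/-- The mean of a cocycle, as a homomorphism from the acting monoid. -/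
def mean (ha : IsAdditiveCocycle a) : G →+ E where
  toFun g := ∫ z, a g z ∂μ
  map_zero' := by simp [ha.map_zero]
  map_add' g h := by
    rw [ha, ← integral_comp_translation g (a h)]
    exact MeasureTheory.integral_add (integrable_of_continuous (a g).continuous)
      (integrable_of_continuous ((a h).comp (translation Z g)).continuous)

end IsAdditiveCocycle

end Invariant

namespace IsAdditiveCocycle

variable [AddCommMonoid G] [AddAction G Z] [ContinuousConstVAdd G Z]
  [NormedAddCommGroup E] [InnerProductSpace ℝ E] [SecondCountableTopology E] {a : G → C(Z, E)}

theorem koopman_eq_of_tendsto [VAddInvariantMeasure G Z μ] [IsFiniteMeasure μ]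
    (ha : IsAdditiveCocycle a) {g : G} {f : Lp E 2 μ}
    (hf : Tendsto (fun n : ℕ => (n : ℝ)⁻¹ • (a (n • g)).toLp 2 μ ℝ) atTop (𝓝 f)) (h : G) :
    koopman E μ h f = f := by
  have hdiff : Tendsto (fun n : ℕ => (n : ℝ)⁻¹ •
      ((a (n • g)).comp (translation Z h) - a (n • g))) atTop (𝓝 0) := by
    refine squeeze_zero_norm (a := fun n : ℕ => (n : ℝ)⁻¹ * (2 * ‖a h‖)) (fun n => ?_) ?_
    · rw [norm_smul, norm_inv, Real.norm_natCast]
      gcongr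
      exact ha.norm_comp_translation_sub_le _ _
    · simpa using tendsto_inv_atTop_nhds_zero_nat.mul_const (2 * ‖a h‖)
  have hLp := ((ContinuousMap.toLp 2 μ ℝ).continuous.tendsto _).comp hdiff
  have hsum := hLp.add hf
  rw [_root_.map_zero, zero_add] at hsum
  refine tendsto_nhds_unique (((koopman E μ h).continuous.tendsto f).comp hf)
    (hsum.congr fun n => ?_)
  simp only [Function.comp_apply, _root_.map_smul, map_sub, koopman_toLp, ← smul_add,
    sub_add_cancel]

theorem exists_tendsto_average [CompleteSpace E] [VAddInvariantMeasure G Z μ] [IsFiniteMeasure μ]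
    (ha : IsAdditiveCocycle a) (g : G) :
    ∃ f, Tendsto (fun n : ℕ => (n : ℝ)⁻¹ • (a (n • g)).toLp 2 μ ℝ) atTop (𝓝 f) := by
  have hlim := (koopman E μ g).toContinuousLinearMap.tendsto_birkhoffAverage_orthogonalProjection
    (LinearIsometry.norm_toContinuousLinearMap_le _) ((a g).toLp 2 μ ℝ)
  refine ⟨_, hlim.congr fun n => ?_⟩
  rw [birkhoffAverage, LinearIsometry.coe_toContinuousLinearMap, ha.birkhoffSum_koopman]

variable [CompleteSpace E] [ErgodicVAdd G Z μ] [IsProbabilityMeasure μ]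

theorem tendsto_average (ha : IsAdditiveCocycle a) (g : G) :
    Tendsto (fun n : ℕ => (n : ℝ)⁻¹ • (a (n • g)).toLp 2 μ ℝ) atTop
      (𝓝 (Lp.const 2 μ (ha.mean μ g))) := by
  obtain ⟨f, hf⟩ := ha.exists_tendsto_average (μ := μ) g
  have hint (n : ℕ) (hn : n ≠ 0) :
      ∫ z, ((n : ℝ)⁻¹ • (a (n • g)).toLp 2 μ ℝ) z ∂μ = ha.mean μ g := by
    rw [← _root_.map_smul, integral_congr_ae (ContinuousMap.coeFn_toLp μ _)]
    simp only [ContinuousMap.smul_apply, integral_smul]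
    change (n : ℝ)⁻¹ • ha.mean μ (n • g) = _
    rw [_root_.map_nsmul, ← Nat.cast_smul_eq_nsmul ℝ, inv_smul_smul₀ (Nat.cast_ne_zero.2 hn)]
  have hfint : ∫ z, f z ∂μ = ha.mean μ g :=
    tendsto_nhds_unique ((continuous_integral_Lp.tendsto f).comp hf)
      (tendsto_const_nhds.congr' <| (eventually_ne_atTop 0).mono fun n hn => (hint n hn).symm)
  rw [← hfint, ← eq_const_of_forall_koopman_eq fun h => ha.koopman_eq_of_tendsto hf h]
  exact hf

theorem le_norm_mean (ha : IsAdditiveCocycle a) {g : G} {c b : ℝ}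
    (hle : ∀ (n : ℕ) (z : Z), n * c - b ≤ ‖a (n • g) z‖) : c ≤ ‖ha.mean μ g‖ := by
  have hnorm : ‖Lp.const 2 μ (ha.mean μ g)‖ = ‖ha.mean μ g‖ := by
    simp [Lp.norm_const' _ _ _ two_ne_zero ENNReal.ofNat_ne_top]
  have hlim : Tendsto (fun n : ℕ => c - (n : ℝ)⁻¹ * b) atTop (𝓝 c) := by
    simpa using tendsto_const_nhds.sub (tendsto_inv_atTop_nhds_zero_nat.mul_const b)
  rw [← hnorm]
  refine le_of_tendsto_of_tendsto hlim (ha.tendsto_average g).norm ?_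
  filter_upwards [eventually_gt_atTop 0] with n hn
  have hscale : c - (n : ℝ)⁻¹ * b = (n : ℝ)⁻¹ * (n * c - b) := by field_simp
  rw [hscale, norm_smul, norm_inv, Real.norm_natCast]
  gcongr
  exact le_norm_toLp (hle n)

end IsAdditiveCocycle

end ErgodicAction

/-! ### The Ruelle–Sullivan map -/

namespace Hull

variable {Λ : DeloneSet d X}

instance : AddAction (Euc d) (Hull Λ) where
  vadd x T := T - x
  zero_vadd := Hull.sub_zero
  add_vadd x y T := by
    change T - (x + y) = T - y - x
    rw [Hull.sub_sub_eq, add_comm]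

instance : ContinuousVAdd (Euc d) (Hull Λ) :=
  ⟨continuous_sub continuous_snd continuous_fst⟩

end Hull

section InvariantProbability

variable {Λ : DeloneSet d X} {μ : Measure (Hull Λ)}

theorem IsInvariantProbability.vaddInvariantMeasure (hμ : IsInvariantProbability μ) :
    VAddInvariantMeasure (Euc d) (Hull Λ) μ where
  measure_preimage_vadd x s hs := by
    conv_rhs => rw [← hμ.invariant x]
    exact (Measure.map_apply (measurable_const_vadd x) hs).symm

theorem IsInvariantProbability.cond (hμ : IsInvariantProbability μ)
    {s : Set (Hull Λ)} (hs : MeasurableSet s) (hs0 : μ s ≠ 0)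
    (hinv : ∀ x : Euc d, (x +ᵥ ·) ⁻¹' s =ᵐ[μ] s) :
    IsInvariantProbability (ProbabilityTheory.cond μ s) := by
  have := hμ.isProbability
  have := hμ.vaddInvariantMeasure
  refine ⟨ProbabilityTheory.cond_isProbabilityMeasure hs0, fun x => Measure.ext fun t ht => ?_⟩
  have hx := measurePreserving_vadd x μ
  calc (ProbabilityTheory.cond μ s).map (x +ᵥ ·) t
      = (μ s)⁻¹ * μ (s ∩ (x +ᵥ ·) ⁻¹' t) := by
        rw [Measure.map_apply hx.measurable ht, ProbabilityTheory.cond_apply hs]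
    _ = (μ s)⁻¹ * μ ((x +ᵥ ·) ⁻¹' (s ∩ t)) := by
        congr 1
        exact measure_congr ((hinv x).symm.inter (ae_eq_refl _))
    _ = ProbabilityTheory.cond μ s t := by
        rw [hx.measure_preimage (hs.inter ht).nullMeasurableSet, ProbabilityTheory.cond_apply hs]

theorem IsUniquelyErgodic.ergodicVAdd (hμ : IsUniquelyErgodic μ) :
    ErgodicVAdd (Euc d) (Hull Λ) μ where
  toVAddInvariantMeasure := hμ.1.vaddInvariantMeasure
  aeconst_of_forall_preimage_vadd_ae_eq {s} hs hinv := by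
    rw [eventuallyConst_set]
    by_cases hs0 : μ s = 0
    · exact .inr (measure_eq_zero_iff_ae_notMem.1 hs0)
    · left
      rw [← hμ.2 _ (hμ.1.cond hs hs0 hinv)]
      exact ProbabilityTheory.ae_cond_mem hs

end InvariantProbability

theorem PEForm.continuous {Λ : DeloneSet d X} (η : PEForm Λ) : Continuous η.toFun := by
  have h0 := η.equivariant 0
  simp only [iteratedFDeriv_zero_eq_comp, Function.comp_apply, Hull.sub_zero] at h0
  exact (LinearIsometryEquiv.comp_continuous_iff _).1 h0

namespace Hull

variable {Λ : DeloneSet d X} {μ : Measure (Hull Λ)}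

/-- The function `α (·, x)` on the hull. -/
def slice (α : C(Hull Λ × Euc d, Euc d)) (x : Euc d) : C(Hull Λ, Euc d) :=
  ⟨fun T => α (T, x), α.continuous.comp (Continuous.prodMk_left x)⟩

theorem isAdditiveCocycle_slice (α : weakCocycles Λ) : IsAdditiveCocycle (slice α.1) :=
  fun x y => ContinuousMap.ext fun T => (α.2 T x y).symm

variable [CompactSpace X]

section Invariant

variable [IsFiniteMeasure μ] [VAddInvariantMeasure (Euc d) (Hull Λ) μ]

variable (μ) in
/-- The mean displacement `x ↦ ∫ α (T, x) dμ` of a cocycle. -/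
def meanDisplacement : weakCocycles Λ →+ Euc d →L[ℝ] Euc d where
  toFun α := ((isAdditiveCocycle_slice α).mean μ).toRealLinearMap <| by
    have := continuous_parametric_integral_of_continuous (μ := μ) (f := fun x T => α.1 (T, x))
      (α.1.continuous.comp continuous_swap) isCompact_univ
    simp only [setIntegral_univ] at this
    exact this
  map_zero' := by
    ext1 _
    exact integral_zero _ _
  map_add' α β := by
    ext1 x
    exact integral_add (integrable_of_continuous (slice α.1 x).continuous)
      (integrable_of_continuous (slice β.1 x).continuous)

theorem meanDisplacement_coboundary (s : C(Hull Λ, Euc d)) :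
    meanDisplacement μ (coboundary s) = 0 := by
  ext1 x
  have hint := integral_sub (μ := μ)
    (integrable_of_continuous (s.comp (translation (Hull Λ) x)).continuous)
    (integrable_of_continuous s.continuous)
  refine hint.trans (sub_eq_zero.2 (integral_comp_translation x s))

variable (μ) in
/-- The Ruelle–Sullivan map. -/
def ruelleSullivan : WeakH1 Λ →+ Euc d →L[ℝ] Euc d :=
  QuotientAddGroup.lift _ (meanDisplacement μ) fun β ⟨s, hs⟩ => by
    have hβ : β = coboundary s := Subtype.ext (ContinuousMap.ext fun z => hs z.1 z.2)
    rw [hβ, AddMonoidHom.mem_ker, meanDisplacement_coboundary]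

variable (μ) in
/-- The matrix of `ruelleSullivan μ c` in the standard basis. -/
def ruelleSullivanMatrix (c : WeakH1 Λ) : Matrix (Fin d) (Fin d) ℝ :=
  LinearMap.toMatrix (EuclideanSpace.basisFun (Fin d) ℝ).toBasis
    (EuclideanSpace.basisFun (Fin d) ℝ).toBasis (ruelleSullivan μ c)

theorem integral_form_apply (η : PEForm Λ) {α : weakCocycles Λ} (hη : η.HasPrimitive α.1)
    (x : Euc d) : ∫ T, η.toFun T x ∂μ = meanDisplacement μ α x := by
  have hηc : Continuous fun T : Hull Λ => η.toFun T x := η.continuous.clm_apply continuous_const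
  have hjoint : Continuous fun z : ℝ × Hull Λ => η.toFun (z.2 - z.1 • x) x :=
    hηc.comp (continuous_sub continuous_snd (continuous_fst.smul continuous_const))
  have hα (T : Hull Λ) : α.1 (T, x) = ∫ t in (0 : ℝ)..1, η.toFun (T - t • x) x := by
    have hderiv (t : ℝ) : HasDerivAt (fun t : ℝ => α.1 (T, t • x)) (η.toFun (T - t • x) x) t := by
      have hline : HasDerivAt (fun t : ℝ => t • x) x t := by
        simpa using (hasDerivAt_id t).smul_const x
      exact (hη T (t • x)).comp_hasDerivAt t hline
    rw [intervalIntegral.integral_eq_sub_of_hasDerivAt (fun t _ => hderiv t)]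
    · simp [cocycle_zero α.2]
    · exact (hjoint.comp (Continuous.prodMk_left T)).intervalIntegrable _ _
  have hint : Integrable (Function.uncurry fun (t : ℝ) (T : Hull Λ) => η.toFun (T - t • x) x)
      ((volume.restrict (Set.uIoc (0 : ℝ) 1)).prod μ) := by
    obtain ⟨K, hK⟩ := isCompact_univ.exists_bound_of_continuousOn hηc.continuousOn
    rw [Set.uIoc_of_le zero_le_one]
    exact Integrable.of_bound hjoint.aestronglyMeasurable K
      (Eventually.of_forall fun z => hK _ trivial)
  calc ∫ T, η.toFun T x ∂μ
      = ∫ t in (0 : ℝ)..1, (∫ T, η.toFun (T - t • x) x ∂μ) := by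
        simp only [fun t : ℝ => show ∫ T, η.toFun (T - t • x) x ∂μ = ∫ T, η.toFun T x ∂μ from
          integral_comp_translation (t • x) ⟨_, hηc⟩]
        simp
    _ = ∫ T, (∫ t in (0 : ℝ)..1, η.toFun (T - t • x) x) ∂μ := intervalIntegral_integral_swap hint
    _ = ∫ T, α.1 (T, x) ∂μ := by simp only [hα]

theorem average_eq_ruelleSullivanMatrix {η : PEForm Λ} {c : WeakH1 Λ} (hη : η.RepresentsWeak c) :
    η.average μ = ruelleSullivanMatrix μ c := by
  obtain ⟨α, hα, rfl⟩ := hη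
  ext i j
  have hint : Integrable (fun T => η.toFun T (EuclideanSpace.single j 1)) μ :=
    integrable_of_continuous (η.continuous.clm_apply continuous_const)
  calc η.average μ i j = (∫ T, η.toFun T (EuclideanSpace.single j 1) ∂μ) i :=
        (EuclideanSpace.proj (𝕜 := ℝ) i).integral_comp_comm hint
    _ = meanDisplacement μ α (EuclideanSpace.single j 1) i := by rw [integral_form_apply η hα]
    _ = ruelleSullivanMatrix μ (QuotientAddGroup.mk α) i j := by
        simp [ruelleSullivanMatrix, LinearMap.toMatrix_apply, ruelleSullivan]

theorem isRuelleSullivanWeak_ruelleSullivanMatrix (c : WeakH1 Λ) :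
    IsRuelleSullivanWeak μ c (ruelleSullivanMatrix μ c) :=
  ⟨exists_representsWeak c, fun _ hη => average_eq_ruelleSullivanMatrix hη⟩

end Invariant

variable [IsProbabilityMeasure μ] [ErgodicVAdd (Euc d) (Hull Λ) μ]

theorem injective_meanDisplacement {α : weakCocycles Λ} {K : ℝ}
    (hα : ∀ (T : Hull Λ) (x : Euc d), ‖x‖ ≤ K * (‖α.1 (T, x)‖ + 1)) :
    Function.Injective (meanDisplacement μ α) := by
  refine (injective_iff_map_eq_zero _).2 fun x hx => ?_
  by_contra hx0
  have hK : 0 < K := pos_of_mul_pos_left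
    ((norm_pos_iff.2 hx0).trans_le (hα (Classical.arbitrary _) x)) (by positivity)
  have hle : ‖x‖ / K ≤ ‖meanDisplacement μ α x‖ := by
    refine (isAdditiveCocycle_slice α).le_norm_mean (b := 1) fun n T => ?_
    have hn : ‖n • x‖ = n * ‖x‖ := by rw [← Nat.cast_smul_eq_nsmul ℝ, norm_smul, Real.norm_natCast]
    rw [sub_le_iff_le_add, ← mul_div_assoc, div_le_iff₀' hK, ← hn]
    exact hα T (n • x)
  rw [hx, norm_zero] at hle
  exact hle.not_gt (div_pos (norm_pos_iff.2 hx0) hK)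

theorem isUnit_ruelleSullivanMatrix {α : weakCocycles Λ} {K : ℝ}
    (hα : ∀ (T : Hull Λ) (x : Euc d), ‖x‖ ≤ K * (‖α.1 (T, x)‖ + 1)) :
    IsUnit (ruelleSullivanMatrix μ (QuotientAddGroup.mk α)) := by
  rw [ruelleSullivanMatrix, LinearMap.isUnit_toMatrix_iff, LinearMap.isUnit_iff_ker_eq_bot]
  exact LinearMap.ker_eq_bot.2 (injective_meanDisplacement hα)

end Hull

/-! ### Local maps -/

namespace DeloneSet

theorem patch_sub_eq {T T' : DeloneSet d X} {R : ℝ} {x : Euc d}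
    (h : T.patch (R + ‖x‖) = T'.patch (R + ‖x‖)) : (T - x).patch R = (T' - x).patch R := by
  have key (S S' : DeloneSet d X) (h : S.patch (R + ‖x‖) = S'.patch (R + ‖x‖)) :
      (S - x).patch R ⊆ (S' - x).patch R := fun p hp => by
    have hpx : (p.1 + x, p.2) ∈ S.patch (R + ‖x‖) :=
      ⟨hp.1, (norm_add_le _ _).trans_lt (by gcongr; exact hp.2)⟩
    exact ⟨(h ▸ hpx).1, hp.2⟩
  exact (key T T' h).antisymm (key T' T h.symm)

/-- The points of `S` of norm less than `R`. -/
def pointsBall (S : DeloneSet d X) (R : ℝ) : Finset (Euc d) :=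
  ((S.finite_patch R).image Prod.fst).toFinset

theorem mem_pointsBall {S : DeloneSet d X} {R : ℝ} {p : Euc d} :
    p ∈ S.pointsBall R ↔ p ∈ S.points ∧ ‖p‖ < R := by
  simp only [pointsBall, Set.Finite.mem_toFinset, patch, points]
  constructor
  · rintro ⟨q, hq, rfl⟩
    exact ⟨⟨q, hq.1, rfl⟩, hq.2⟩
  · rintro ⟨⟨q, hq, rfl⟩, hn⟩
    exact ⟨q, ⟨hq, hn⟩, rfl⟩

theorem pointsBall_eq {S T : DeloneSet d X} {R : ℝ} (h : S.patch R = T.patch R) :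
    S.pointsBall R = T.pointsBall R := by
  simp only [pointsBall, h]

theorem exists_mem_pointsBall {S : DeloneSet d X} {R R' : ℝ} (h : IsCoveringBy R S.carrier)
    (hR : R < R') : ∃ p, p ∈ S.pointsBall R' := by
  obtain ⟨p, hp, hpR⟩ := h 0
  exact ⟨p.1, mem_pointsBall.2 ⟨⟨p, hp, rfl⟩, by rw [dist_zero_right] at hpR; linarith⟩⟩

theorem sum_nearPoint_pointsBall {E : Type*} [AddCommMonoid E] {r η R : ℝ} {S T : DeloneSet d X}
    (hS : IsSeparatedBy r S.carrier) (hT : IsSeparatedBy r T.carrier) (hη : 2 * η ≤ r)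
    (hη1 : η ≤ 1) (hTS : ∀ p ∈ T.pointsBall (R + 1), p ∈ thickening η S.points)
    (hST : S.patch R ⊆ thickening η T.carrier) {g : Euc d → E} (hg : ∀ p, R ≤ ‖p‖ → g p = 0) :
    ∑ p ∈ T.pointsBall (R + 1), g (nearPoint η p S) = ∑ p ∈ S.pointsBall R, g p := by
  classical
  have hinj : Set.InjOn (fun p => nearPoint η p S) (T.pointsBall (R + 1)) := by
    intro p hp q hq (hpq : nearPoint η p S = nearPoint η q S)
    refine hT.pairwise_points.eq (mem_pointsBall.1 hp).1 (mem_pointsBall.1 hq).1 (not_le.2 ?_)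
    have hp' := (nearPoint_spec (hTS p hp)).2
    have hq' := (nearPoint_spec (hTS q hq)).2
    rw [hpq] at hp'
    linarith [dist_triangle_right p q (nearPoint η q S)]
  rw [← Finset.sum_image hinj]
  symm
  refine Finset.sum_subset (fun q hq => ?_) fun q hq hqR => ?_
  · obtain ⟨⟨q, hqS, rfl⟩, hqR⟩ := mem_pointsBall.1 hq
    obtain ⟨p, hp, hqp⟩ := mem_thickening_iff.1 (hST ⟨hqS, hqR⟩)
    have hpq : dist p.1 q.1 < η := by
      rw [dist_comm]
      exact (le_max_left _ _).trans_lt hqp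
    refine Finset.mem_image.2 ⟨p.1, mem_pointsBall.2 ⟨⟨p, hp, rfl⟩, ?_⟩,
      nearPoint_eq hS hη ⟨q, hqS, rfl⟩ hpq⟩
    have := norm_le_norm_add_norm_sub' p.1 q.1
    rw [← dist_eq_norm] at this
    linarith
  · obtain ⟨p, hp, rfl⟩ := Finset.mem_image.1 hq
    refine hg _ (not_lt.1 fun hlt => hqR ?_)
    exact mem_pointsBall.2 ⟨(nearPoint_spec (hTS p hp)).1, hlt⟩

end DeloneSet

theorem IsStronglyPE.sub {Λ : DeloneSet d X} {A : Type*} {f : Hull Λ → A} (hf : IsStronglyPE f)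
    (x : Euc d) : IsStronglyPE fun T : Hull Λ => f (T - x) := by
  obtain ⟨R, hR, h⟩ := hf
  exact ⟨R + ‖x‖, by positivity, fun T T' hT => h _ _ (DeloneSet.patch_sub_eq hT)⟩

namespace Hull

variable {Λ : DeloneSet d X} {Λ' : DeloneSet d Y}

/-! ### Translations are determined by patches -/

theorem exists_forall_eq_zero_of_patch_sub_eq [CompactSpace X] (haper : IsAperiodic Λ) (M : ℝ) :
    ∃ R > 0, ∀ (T : Hull Λ) (u : Euc d), ‖u‖ ≤ M →
      (T - u).1.patch R = T.1.patch R → u = 0 := by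
  obtain ⟨ε, hε, hsep⟩ := exists_isSeparatedBy Λ
  obtain ⟨R₀, -, hcov⟩ := exists_isCoveringBy Λ
  -- By compactness, translations by vectors of norm between `ε` and `M` move every element of the
  -- hull by a definite amount.
  let K : Set (Hull Λ × Euc d) := Set.univ ×ˢ (closedBall 0 M ∩ {u | ε ≤ ‖u‖})
  have hK : IsCompact K := isCompact_univ.prod
    ((isCompact_closedBall _ _).inter_right (isClosed_le continuous_const continuous_norm))
  have hV : ((fun z : Hull Λ × Euc d => (z.1 - z.2, z.1)) '' K)ᶜ ∈ 𝓤 (Hull Λ) := by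
    rw [compactSpace_uniformity, mem_iSup]
    intro T
    refine (hK.image (by fun_prop)).isClosed.isOpen_compl.mem_nhds ?_
    rintro ⟨⟨S, u⟩, ⟨-, -, hu : ε ≤ ‖u‖⟩, hS⟩
    have hper : S - u = S := (congrArg Prod.fst hS).trans (congrArg Prod.snd hS).symm
    rw [haper S u hper, norm_zero] at hu
    exact hu.not_gt hε
  obtain ⟨R, hR, hRV⟩ := exists_forall_patch_eq_mem hV
  refine ⟨max R (R₀ + 1), lt_max_of_lt_left hR, fun T u huM hTu => ?_⟩
  have hu : ‖u‖ < ε := by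
    by_contra! hcon
    exact hRV _ _ (DeloneSet.patch_mono (le_max_left _ _) hTu)
      ⟨(T, u), ⟨trivial, mem_closedBall_zero_iff.2 huM, hcon⟩, rfl⟩
  obtain ⟨p, hp, hpR⟩ := hcov T 0
  rw [dist_zero_right] at hpR
  have hpu : p ∈ (T - u).1.patch (max R (R₀ + 1)) :=
    hTu ▸ ⟨hp, by linarith [le_max_right R (R₀ + 1)]⟩
  have heq := (hsep T).eq_of_dist_lt (DeloneSet.mem_sub.1 hpu.1) hp
    (by simpa [dist_eq_norm] using hu)
  simpa using congrArg Prod.fst heq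

theorem exists_forall_eq_of_patch_sub_eq [CompactSpace X] (haper : IsAperiodic Λ) (M : ℝ) :
    ∃ R > 0, ∀ (S S' : Hull Λ) (u u' : Euc d), ‖u‖ ≤ M → ‖u'‖ ≤ M →
      S.1.patch R = S'.1.patch R → (S - u).1.patch R = (S' - u').1.patch R → u = u' := by
  obtain ⟨R, hR, h⟩ := exists_forall_eq_zero_of_patch_sub_eq haper (M + M)
  refine ⟨R + |M|, by positivity, fun S S' u u' hu hu' hS hSu => ?_⟩
  refine (sub_eq_zero.1 (h (S - u) (u' - u) ((norm_sub_le _ _).trans (add_le_add hu' hu)) ?_)).symm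
  rw [Hull.sub_sub_eq, add_sub_cancel]
  calc (S - u').1.patch R = (S' - u').1.patch R :=
        DeloneSet.patch_sub_eq (DeloneSet.patch_mono (by linarith [le_abs_self M]) hS)
    _ = (S - u).1.patch R := (DeloneSet.patch_mono (by linarith [abs_nonneg M]) hSu).symm

theorem isUniformlyPE_of_isLocalMap [CompactSpace X] [CompactSpace Y] (haper' : IsAperiodic Λ')
    {g : Hull Λ → Hull Λ'} (hg : IsLocalMap g) {α : C(Hull Λ × Euc d, Euc d)}
    (hα : IsCocycleOf g α) : IsUniformlyPE α := by
  intro M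
  obtain ⟨K, hK⟩ := exists_forall_norm_le α M
  obtain ⟨r, hr, hdet⟩ := exists_forall_eq_of_patch_sub_eq haper' K
  obtain ⟨R, hR, hloc⟩ := hg r hr
  refine ⟨R + |M|, by positivity, fun T T' hT x hx => ?_⟩
  refine hdet (g T) (g T') _ _ (hK T x hx) (hK T' x hx)
    (hloc _ _ (DeloneSet.patch_mono (by linarith [abs_nonneg M]) hT)) ?_
  rw [← hα, ← hα]
  exact hloc _ _ (DeloneSet.patch_sub_eq (DeloneSet.patch_mono (by linarith [le_abs_self M]) hT))

theorem isStronglyPE_sub_of_isLocalMap [CompactSpace X] [CompactSpace Y]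
    (haper' : IsAperiodic Λ') {h : Hull Λ → Hull Λ'} {s t : C(Hull Λ, Euc d)}
    (hs : IsLocalMap fun T => h T - s T) (ht : IsLocalMap fun T => h T - t T) :
    IsStronglyPE (s - t) := by
  obtain ⟨K, hK⟩ := isCompact_univ.exists_bound_of_continuousOn (s - t).continuous.continuousOn
  obtain ⟨r, hr, hdet⟩ := exists_forall_eq_of_patch_sub_eq haper' K
  obtain ⟨R, hR, hlocs⟩ := hs r hr
  obtain ⟨R', -, hloct⟩ := ht r hr
  refine ⟨max R R', lt_max_of_lt_left hR, fun T T' hT => ?_⟩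
  refine hdet (h T - t T) (h T' - t T') _ _ (hK T trivial) (hK T' trivial)
    (hloct _ _ (DeloneSet.patch_mono (le_max_right _ _) hT)) ?_
  have := hlocs _ _ (DeloneSet.patch_mono (le_max_left _ _) hT)
  simpa [Hull.sub_sub_eq] using this

/-! ### Averages over the points of a pattern -/

theorem continuous_sum_pointsBall {E : Type*} [TopologicalSpace E] [AddCommMonoid E]
    [ContinuousAdd E] {f : Hull Λ × Euc d → E} (hf : ContinuousOn f {z | z.2 ∈ z.1.1.points})
    {R : ℝ} (hR : ∀ T p, R ≤ ‖p‖ → f (T, p) = 0) :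
    Continuous fun T : Hull Λ => ∑ p ∈ T.1.pointsBall R, f (T, p) := by
  obtain ⟨r, hr, hsep⟩ := exists_isSeparatedBy Λ
  have hη : 0 < min (r / 2) 1 := by positivity
  have hηr : 2 * min (r / 2) 1 ≤ r := by linarith [min_le_left (r / 2) 1]
  set η := min (r / 2) 1
  refine continuous_iff_continuousAt.2 fun T => ?_
  have hTS : ∀ᶠ S : Hull Λ in 𝓝 T, ∀ p ∈ T.1.pointsBall (R + 1), p ∈ thickening η S.1.points :=
    (T.1.pointsBall (R + 1)).eventually_all.2 fun p hp =>
      eventually_mem_thickening_points (DeloneSet.mem_pointsBall.1 hp).1 hη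
  have hST := mem_nhds_right T (patch_subset_thickening_mem_uniformity (Λ := Λ) R hη)
  refine ContinuousAt.congr (f := fun S : Hull Λ =>
    ∑ p ∈ T.1.pointsBall (R + 1), f (S, S.1.nearPoint η p)) ?_ ?_
  · refine tendsto_finsetSum _ fun p hp => ?_
    have hpT : p ∈ thickening η T.1.points :=
      self_subset_thickening hη _ (DeloneSet.mem_pointsBall.1 hp).1
    have hnhds := (isOpen_setOf_mem_thickening_points η p).mem_nhds hpT
    refine (hf _ (DeloneSet.nearPoint_spec hpT).1).tendsto.comp (tendsto_nhdsWithin_iff.2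
      ⟨continuousAt_id.prodMk ((continuousOn_nearPoint hsep hηr p).continuousAt hnhds), ?_⟩)
    filter_upwards [hnhds] with S hS using (DeloneSet.nearPoint_spec hS).1
  · filter_upwards [hTS, hST] with S hS hS'
    exact DeloneSet.sum_nearPoint_pointsBall (hsep S) (hsep T) hηr (min_le_right _ _) hS hS'
      (hR S)

/-- The weighted average of `a (T, p)` over the points `p` of `T` of norm less than `ρ`. The weights
`ρ - ‖p‖` vanish on the boundary of the ball, which makes the average continuous in `T`. -/
def tentAverage (ρ : ℝ) (a : Hull Λ × Euc d → Euc d) (T : Hull Λ) : Euc d :=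
  (T.1.pointsBall ρ).centerMass (fun p => max 0 (ρ - ‖p‖)) fun p => a (T, p)

theorem sum_tent_pos {R ρ : ℝ} (hρ : R < ρ) {T : Hull Λ} (hT : IsCoveringBy R T.1.carrier) :
    0 < ∑ p ∈ T.1.pointsBall ρ, max 0 (ρ - ‖p‖) := by
  obtain ⟨p, hp⟩ := DeloneSet.exists_mem_pointsBall hT hρ
  exact Finset.sum_pos' (fun _ _ => le_max_left _ _)
    ⟨p, hp, lt_max_of_lt_right (sub_pos.2 (DeloneSet.mem_pointsBall.1 hp).2)⟩

theorem continuous_tentAverage {R ρ : ℝ} (hρ : R < ρ)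
    (hcov : ∀ T : Hull Λ, IsCoveringBy R T.1.carrier) {a : Hull Λ × Euc d → Euc d}
    (ha : ContinuousOn a {z | z.2 ∈ z.1.1.points}) : Continuous (tentAverage ρ a) := by
  have hw : Continuous fun z : Hull Λ × Euc d => max 0 (ρ - ‖z.2‖) := by fun_prop
  have hw0 (p : Euc d) (hp : ρ ≤ ‖p‖) : max 0 (ρ - ‖p‖) = 0 := max_eq_left (sub_nonpos.2 hp)
  refine ((continuous_sum_pointsBall hw.continuousOn fun _ => hw0).inv₀
    fun T => (sum_tent_pos hρ (hcov T)).ne').smul ?_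
  exact continuous_sum_pointsBall (hw.continuousOn.smul ha) fun T p hp =>
    smul_eq_zero_of_left (hw0 p hp) _

theorem tentAverage_sub {R ρ : ℝ} (hρ : R < ρ) {T : Hull Λ} (hT : IsCoveringBy R T.1.carrier)
    (a : Hull Λ × Euc d → Euc d) (c : Euc d) :
    tentAverage ρ a T - c = tentAverage ρ (fun z => a z - c) T := by
  simp only [tentAverage, Finset.centerMass, smul_sub, Finset.sum_sub_distrib, ← Finset.sum_smul,
    inv_smul_smul₀ (sum_tent_pos hρ hT).ne']

end Hull

/-! ### Making a continuous map local -/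

namespace Hull

variable {Λ : DeloneSet d X} {Λ' : DeloneSet d Y} {h : Hull Λ → Hull Λ'}

theorem exists_forall_thickening_points [CompactSpace X] (hc : Continuous h) (ρ : ℝ) {η : ℝ}
    (hη : 0 < η) : ∃ R > 0, ∀ S T : Hull Λ, S.1.patch R = T.1.patch R →
      ∀ p ∈ (h S).1.pointsBall ρ, p ∈ thickening η (h T).1.points := by
  obtain ⟨R, hR, hRV⟩ := exists_forall_patch_eq_mem
    (CompactSpace.uniformContinuous_of_continuous hc
      (patch_subset_thickening_mem_uniformity (Λ := Λ') ρ hη))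
  refine ⟨R, hR, fun S T hST p hp => ?_⟩
  obtain ⟨⟨p, hpS, rfl⟩, hpρ⟩ := DeloneSet.mem_pointsBall.1 hp
  obtain ⟨q, hq, hpq⟩ := mem_thickening_iff.1 (hRV S T hST ⟨hpS, hpρ⟩)
  exact mem_thickening_iff.2 ⟨q.1, ⟨q, hq, rfl⟩, (le_max_left _ _).trans_lt hpq⟩

theorem exists_continuousOn_sub_mem_transversal [CompactSpace X] [CompactSpace Y]
    (hΛ : Λ.IsFLC) (hc : Continuous h) : ∃ σ : Hull Λ → Euc d, ContinuousOn σ (transversal Λ) ∧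
      Set.MapsTo (fun T => h T - σ T) (transversal Λ) (transversal Λ') := by
  obtain ⟨r, hr, hsep⟩ := exists_isSeparatedBy Λ'
  obtain ⟨R₀, -, hcov⟩ := exists_isCoveringBy Λ'
  obtain ⟨R, -, hR⟩ := exists_forall_thickening_points hc (R₀ + 1) (half_pos hr)
  -- By FLC the patches of radius `R` cut the transversal into clopen pieces; on each of them, the
  -- chosen point is the one close to a fixed position.
  have hpos (P : Set (Euc d × X)) : ∃ p : Euc d, ∀ T : Hull Λ, T.1.patch R = P →
      p ∈ thickening (r / 2) (h T).1.points := by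
    by_cases hP : ∃ T₀ : Hull Λ, T₀.1.patch R = P
    · obtain ⟨T₀, rfl⟩ := hP
      obtain ⟨p, hp⟩ := DeloneSet.exists_mem_pointsBall (hcov (h T₀)) (lt_add_one R₀)
      exact ⟨p, fun T hT => hR T₀ T hT.symm p hp⟩
    · exact ⟨0, fun T hT => absurd ⟨T, hT⟩ hP⟩
  choose p hp using hpos
  refine ⟨fun T => (h T).1.nearPoint (r / 2) (p (T.1.patch R)), fun T hT => ?_, fun T _ =>
    sub_mem_transversal.2 (DeloneSet.nearPoint_spec (hp _ T rfl)).1⟩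
  have hcont : ContinuousAt (fun S : Hull Λ => (h S).1.nearPoint (r / 2) (p (T.1.patch R))) T :=
    ContinuousAt.comp (f := h) (g := fun S : Hull Λ' => S.1.nearPoint (r / 2) (p (T.1.patch R)))
      ((continuousOn_nearPoint hsep (by linarith) _).continuousAt
        ((isOpen_setOf_mem_thickening_points _ _).mem_nhds (hp _ T rfl))) hc.continuousAt
  refine hcont.continuousWithinAt.congr_of_eventuallyEq ?_ rfl
  have hpatch := mem_nhds_left T (patch_eq_mem_uniformity_of_isFLC hΛ R)
  filter_upwards [mem_nhdsWithin_of_mem_nhds hpatch, self_mem_nhdsWithin] with S hST hS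
  rw [← hST hT hS]

theorem exists_forall_patch_eq_of_continuousOn [CompactSpace X] (hΛ' : Λ'.IsFLC)
    (hc : ContinuousOn h (transversal Λ))
    (hmaps : Set.MapsTo h (transversal Λ) (transversal Λ')) (r : ℝ) :
    ∃ R > 0, ∀ T ∈ transversal Λ, ∀ T' ∈ transversal Λ, T.1.patch R = T'.1.patch R →
      (h T).1.patch r = (h T').1.patch r := by
  have huc := isClosed_transversal.isCompact.uniformContinuousOn_of_continuous hc
  obtain ⟨R, hR, hRV⟩ := exists_forall_patch_eq_mem
    (mem_inf_principal.1 (huc (patch_eq_mem_uniformity_of_isFLC hΛ' r)))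
  exact ⟨R, hR, fun T hT T' hT' hTT' => hRV T T' hTT' ⟨hT, hT'⟩ (hmaps hT) (hmaps hT')⟩

/-- A bounded displacement `a (T, p)`, depending continuously on an element `T` of the hull and on a
point `p` of `T` of norm less than `ρ`, for which `h T - a (T, p)` is determined by patches of
`T`. -/
structure IsLocalDisplacement (h : Hull Λ → Hull Λ') (ρ : ℝ) (a : Hull Λ × Euc d → Euc d) :
    Prop where
  continuousOn : ContinuousOn a {z | z.2 ∈ z.1.1.points}
  exists_norm_le : ∃ K, ∀ T : Hull Λ, ∀ p ∈ T.1.pointsBall ρ, ‖a (T, p)‖ ≤ K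
  exists_patch_eq : ∀ r, ∃ R > 0, ∀ T T' : Hull Λ, T.1.patch R = T'.1.patch R →
    ∀ p ∈ T.1.pointsBall ρ, (h T - a (T, p)).1.patch r = (h T' - a (T', p)).1.patch r

theorem exists_isLocalDisplacement [CompactSpace X] [CompactSpace Y] (hΛ : Λ.IsFLC)
    (hΛ' : Λ'.IsFLC) (hc : Continuous h) {α : C(Hull Λ × Euc d, Euc d)} (hα : IsCocycleOf h α)
    (ρ : ℝ) : ∃ a, IsLocalDisplacement h ρ a := by
  obtain ⟨σ, hσ, hσmaps⟩ := exists_continuousOn_sub_mem_transversal hΛ hc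
  have ha (T : Hull Λ) (p : Euc d) :
      h (T - p) - σ (T - p) = h T - (α (T, p) + σ (T - p)) := by
    rw [hα, Hull.sub_sub_eq]
  refine ⟨fun z => α z + σ (z.1 - z.2), ?_, ?_, fun r => ?_⟩
  · exact α.continuous.continuousOn.add (hσ.comp
      (continuous_sub continuous_fst continuous_snd).continuousOn fun z hz =>
        sub_mem_transversal.2 hz)
  · obtain ⟨Kσ, hKσ⟩ := isClosed_transversal.isCompact.exists_bound_of_continuousOn hσ
    obtain ⟨Kα, hKα⟩ := exists_forall_norm_le α ρ
    refine ⟨Kα + Kσ, fun T p hp => ?_⟩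
    rw [DeloneSet.mem_pointsBall] at hp
    exact norm_add_le_of_le (hKα T p hp.2.le) (hKσ _ (sub_mem_transversal.2 hp.1))
  · obtain ⟨R, hR, hloc⟩ :=
      exists_forall_patch_eq_of_continuousOn hΛ' (continuousOn_sub hc.continuousOn hσ) hσmaps r
    refine ⟨R + |ρ|, by positivity, fun T T' hT p hp => ?_⟩
    have hball : T.1.pointsBall ρ = T'.1.pointsBall ρ :=
      DeloneSet.pointsBall_eq (DeloneSet.patch_mono (by linarith [le_abs_self ρ]) hT)
    have hp' := hball ▸ hp
    rw [DeloneSet.mem_pointsBall] at hp hp'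
    simp only [← ha]
    refine hloc _ (sub_mem_transversal.2 hp.1) _ (sub_mem_transversal.2 hp'.1)
      (DeloneSet.patch_sub_eq (DeloneSet.patch_mono ?_ hT))
    linarith [le_abs_self ρ]

namespace IsLocalDisplacement

variable {ρ : ℝ} {a : Hull Λ × Euc d → Euc d}

theorem exists_sub_eq [CompactSpace Y] (ha : IsLocalDisplacement h ρ a)
    (haper' : IsAperiodic Λ') : ∃ R > 0, ∀ T T' : Hull Λ, T.1.patch R = T'.1.patch R →
      ∀ p ∈ T.1.pointsBall ρ, ∀ q ∈ T.1.pointsBall ρ,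
        a (T, q) - a (T, p) = a (T', q) - a (T', p) := by
  obtain ⟨K, hK⟩ := ha.exists_norm_le
  obtain ⟨r, -, hdet⟩ := exists_forall_eq_of_patch_sub_eq haper' (K + K)
  obtain ⟨R, hR, hloc⟩ := ha.exists_patch_eq r
  refine ⟨max R ρ, lt_max_of_lt_left hR, fun T T' hT p hp q hq => ?_⟩
  have hball := DeloneSet.pointsBall_eq (DeloneSet.patch_mono (le_max_right R ρ) hT)
  have hloc := hloc T T' (DeloneSet.patch_mono (le_max_left R ρ) hT)
  refine hdet (h T - a (T, p)) (h T' - a (T', p)) _ _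
    (norm_sub_le_of_le (hK T q hq) (hK T p hp))
    (norm_sub_le_of_le (hK T' q (hball ▸ hq)) (hK T' p (hball ▸ hp))) (hloc p hp) ?_
  simpa only [Hull.sub_sub_eq, add_sub_cancel] using hloc q hq

theorem isLocalMap_sub_tentAverage [CompactSpace X] [CompactSpace Y]
    (ha : IsLocalDisplacement h ρ a) (haper' : IsAperiodic Λ') {R : ℝ} (hρ : R < ρ)
    (hcov : ∀ T : Hull Λ, IsCoveringBy R T.1.carrier) :
    IsLocalMap fun T => h T - tentAverage ρ a T := by
  obtain ⟨Ka, hKa⟩ := ha.exists_norm_le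
  obtain ⟨Ks, hKs⟩ := isCompact_univ.exists_bound_of_continuousOn
    (continuous_tentAverage hρ hcov ha.continuousOn).continuousOn
  obtain ⟨R₁, hR₁, hdiff⟩ := ha.exists_sub_eq haper'
  intro r _
  obtain ⟨R₂, -, hloc⟩ := ha.exists_patch_eq (r + (Ks + Ka))
  refine ⟨max (max R₁ R₂) ρ, lt_max_of_lt_left (lt_max_of_lt_left hR₁), fun T T' hT => ?_⟩
  have hT₁ := DeloneSet.patch_mono ((le_max_left R₁ R₂).trans (le_max_left _ ρ)) hT
  have hT₂ := DeloneSet.patch_mono ((le_max_right R₁ R₂).trans (le_max_left _ ρ)) hT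
  have hball := DeloneSet.pointsBall_eq (DeloneSet.patch_mono (le_max_right _ ρ) hT)
  obtain ⟨p, hp⟩ := DeloneSet.exists_mem_pointsBall (hcov T) hρ
  -- Both `h T - a (T, p)` and the remaining displacement `tentAverage ρ a T - a (T, p)`, an average
  -- of the differences `a (T, q) - a (T, p)`, are determined by patches.
  have hs : tentAverage ρ a T - a (T, p) = tentAverage ρ a T' - a (T', p) := by
    rw [tentAverage_sub hρ (hcov T), tentAverage_sub hρ (hcov T'), tentAverage, tentAverage,
      ← hball]
    simp only [Finset.centerMass]
    congr 1
    exact Finset.sum_congr rfl fun q hq => by rw [hdiff T T' hT₁ p hp q hq]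
  have hsplit (S : Hull Λ) :
      h S - tentAverage ρ a S = h S - a (S, p) - (tentAverage ρ a S - a (S, p)) := by
    rw [Hull.sub_sub_eq, add_sub_cancel]
  simp only [hsplit, ← hs]
  refine DeloneSet.patch_sub_eq (DeloneSet.patch_mono (R := r + (Ks + Ka)) ?_ (hloc T T' hT₂ p hp))
  gcongr
  exact norm_sub_le_of_le (hKs T trivial) (hKa T p hp)

end IsLocalDisplacement

theorem exists_isLocalMap_sub [CompactSpace X] [CompactSpace Y] (haper' : IsAperiodic Λ')
    (hΛ : Λ.IsFLC) (hΛ' : Λ'.IsFLC) (hc : Continuous h) {α : C(Hull Λ × Euc d, Euc d)}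
    (hα : IsCocycleOf h α) : ∃ s : C(Hull Λ, Euc d), IsLocalMap fun T => h T - s T := by
  obtain ⟨R, -, hcov⟩ := exists_isCoveringBy Λ
  obtain ⟨a, ha⟩ := exists_isLocalDisplacement hΛ hΛ' hc hα (R + 1)
  exact ⟨⟨_, continuous_tentAverage (lt_add_one R) hcov ha.continuousOn⟩,
    ha.isLocalMap_sub_tentAverage haper' (lt_add_one R) hcov⟩

/-! ### The strong class -/

theorem strongCocycles_le_weakCocycles : strongCocycles Λ ≤ weakCocycles Λ := fun _ hα => hα.1

theorem IsUniformlyPE.mem_strongCocycles {α : C(Hull Λ × Euc d, Euc d)} (hα : IsUniformlyPE α)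
    (hα' : α ∈ weakCocycles Λ) : α ∈ strongCocycles Λ :=
  ⟨hα', fun v => (hα ‖v‖).imp fun _ hR => ⟨hR.1, fun T T' hT => hR.2 T T' hT v le_rfl⟩⟩

/-- The map forgetting that a class is strong. -/
def strongToWeakH1 : StrongH1 Λ →+ WeakH1 Λ :=
  QuotientAddGroup.map _ _ (AddSubgroup.inclusion strongCocycles_le_weakCocycles)
    fun _ ⟨s, _, hs⟩ => ⟨s, hs⟩

theorem coboundary_mem_strongCocycles {s : C(Hull Λ, Euc d)} (hs : IsStronglyPE s) :
    (coboundary s).1 ∈ strongCocycles Λ :=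
  ⟨(coboundary s).2, fun v => by
    simpa only [coboundary_apply] using (hs.sub v).comp₂ hs (· - ·)⟩

theorem IsUniformlyPE.exists_representsStrong [CompactSpace X] {α : strongCocycles Λ}
    (hα : IsUniformlyPE α.1) : ∃ η : PEForm Λ, η.RepresentsStrong (QuotientAddGroup.mk α) := by
  let β : weakCocycles Λ := AddSubgroup.inclusion strongCocycles_le_weakCocycles α
  have hs := hα.isStronglyPE_mollificationTransfer default
  refine ⟨mollifiedForm default β, IsUniformlyPE.isStronglyPE_mollifiedForm default hα,
    α + ⟨_, coboundary_mem_strongCocycles hs⟩, hasPrimitive_mollifiedForm default β,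
    QuotientAddGroup.mk_add_of_mem _ ⟨_, hs, fun T v => coboundary_apply _ T v⟩⟩

end Hull

/-! ### The class of a homeomorphism -/

section HomeomorphismClass

open Hull

variable {Λ : DeloneSet d X} {Λ' : DeloneSet d Y} {h : Hull Λ ≃ₜ Hull Λ'}

theorem PEForm.RepresentsStrong.representsWeak {η : PEForm Λ} {c : StrongH1 Λ}
    (hη : η.RepresentsStrong c) : η.RepresentsWeak (strongToWeakH1 c) := by
  obtain ⟨-, α, hα, rfl⟩ := hη
  exact ⟨AddSubgroup.inclusion strongCocycles_le_weakCocycles α, hα, rfl⟩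

theorem IsCocycleOf.add_coboundary {h : Hull Λ → Hull Λ'} {α : weakCocycles Λ}
    (hα : IsCocycleOf h α.1) (s : C(Hull Λ, Euc d)) :
    IsCocycleOf (fun T => h T - s T) (α + coboundary s).1 := by
  intro T x
  change h (T - x) - s (T - x) = h T - s T - (α.1 (T, x) + (coboundary s).1 (T, x))
  rw [coboundary_apply, hα, Hull.sub_sub_eq, Hull.sub_sub_eq]
  congr 1
  abel

theorem IsWeakClassOf.unique (haper' : IsAperiodic Λ') {c c' : WeakH1 Λ} (hc : IsWeakClassOf h c)
    (hc' : IsWeakClassOf h c') : c = c' := by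
  obtain ⟨α, hα, rfl⟩ := hc
  obtain ⟨β, hβ, rfl⟩ := hc'
  rw [Subtype.ext (isCocycleOf_unique haper' hα hβ)]

theorem IsStrongClassOf.strongToWeakH1_eq (haper' : IsAperiodic Λ')
    {α : weakCocycles Λ} (hα : IsCocycleOf h α.1) {c : StrongH1 Λ} (hc : IsStrongClassOf h c) :
    strongToWeakH1 c = QuotientAddGroup.mk α := by
  obtain ⟨s, -, γ, hγ, rfl⟩ := hc
  exact weakH1_mk_eq_mk_iff.2
    ⟨s, Subtype.ext (isCocycleOf_unique haper' hγ (hα.add_coboundary s))⟩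

variable [CompactSpace X] [CompactSpace Y]

theorem IsStrongClassOf.exists_representsStrong (haper' : IsAperiodic Λ')
    {c : StrongH1 Λ} (hc : IsStrongClassOf h c) : ∃ η : PEForm Λ, η.RepresentsStrong c := by
  obtain ⟨s, hs, γ, hγ, rfl⟩ := hc
  exact (isUniformlyPE_of_isLocalMap haper' hs hγ).exists_representsStrong

theorem exists_isStrongClassOf (haper' : IsAperiodic Λ') (hΛ : Λ.IsFLC) (hΛ' : Λ'.IsFLC)
    {α : weakCocycles Λ} (hα : IsCocycleOf h α.1) : ∃ c : StrongH1 Λ, IsStrongClassOf h c := by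
  obtain ⟨s, hs⟩ := exists_isLocalMap_sub haper' hΛ hΛ' h.continuous hα
  have hγ := hα.add_coboundary s
  have hPE := isUniformlyPE_of_isLocalMap haper' hs hγ
  exact ⟨_, s, hs, ⟨_, hPE.mem_strongCocycles (α + coboundary s).2⟩, hγ, rfl⟩

theorem IsStrongClassOf.unique (haper' : IsAperiodic Λ') {c c' : StrongH1 Λ}
    (hc : IsStrongClassOf h c) (hc' : IsStrongClassOf h c') : c = c' := by
  obtain ⟨s, hs, β, hβ, rfl⟩ := hc
  obtain ⟨t, ht, γ, hγ, rfl⟩ := hc'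
  let β' : weakCocycles Λ := AddSubgroup.inclusion strongCocycles_le_weakCocycles β
  have hβγ := IsCocycleOf.add_coboundary (α := β') hβ (t - s)
  simp only [ContinuousMap.sub_apply, Hull.sub_sub_eq, add_sub_cancel] at hβγ
  refine QuotientAddGroup.eq.2 ⟨t - s, isStronglyPE_sub_of_isLocalMap haper' ht hs, fun T v => ?_⟩
  change -β.1 (T, v) + γ.1 (T, v) = (t - s) (T - v) - (t - s) T
  rw [isCocycleOf_unique haper' hγ hβγ, ← coboundary_apply]
  exact neg_add_cancel_left _ _

variable {μ : Measure (Hull Λ)} [IsFiniteMeasure μ] [VAddInvariantMeasure (Euc d) (Hull Λ) μ]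

theorem IsStrongClassOf.isRuelleSullivanStrong (haper' : IsAperiodic Λ')
    {α : weakCocycles Λ} (hα : IsCocycleOf h α.1) {c : StrongH1 Λ} (hc : IsStrongClassOf h c) :
    IsRuelleSullivanStrong μ c (ruelleSullivanMatrix μ (QuotientAddGroup.mk α)) where
  exists_form := hc.exists_representsStrong haper'
  average_eq η hη := by
    rw [average_eq_ruelleSullivanMatrix hη.representsWeak, hc.strongToWeakH1_eq haper' hα]

theorem exists_isCocycleOf_norm_le (haper : IsAperiodic Λ) (haper' : IsAperiodic Λ')
    (h : Hull Λ ≃ₜ Hull Λ') (hh : IsOrbitEquivalence h ∨ (Λ.IsFLC ∧ Λ'.IsFLC)) :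
    ∃ α : weakCocycles Λ, IsCocycleOf h α.1 ∧
      ∃ K : ℝ, ∀ (T : Hull Λ) (x : Euc d), ‖x‖ ≤ K * (‖α.1 (T, x)‖ + 1) := by
  obtain ⟨α, hα⟩ := exists_isCocycleOf_homeomorph haper' (hh.imp_right And.right)
  obtain ⟨β, hβ⟩ := exists_isCocycleOf_homeomorph (h := h.symm) haper
    (hh.imp isOrbitEquivalence_symm And.left)
  exact ⟨α, hα, exists_norm_le_cocycle haper hα β.2 hβ⟩

end HomeomorphismClass

end Tiling

end

theorem mainTheorem3_general {d : ℕ} {X Y : Type*} [MetricSpace X] [CompactSpace X]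
    [MetricSpace Y] [CompactSpace Y] (Λ : Tiling.DeloneSet d X) (Λ' : Tiling.DeloneSet d Y)
    (haper : Tiling.IsAperiodic Λ) (haper' : Tiling.IsAperiodic Λ')
    (μ : MeasureTheory.Measure (Tiling.Hull Λ)) [MeasureTheory.IsProbabilityMeasure μ]
    [ErgodicVAdd (Tiling.Euc d) (Tiling.Hull Λ) μ] (h : Tiling.Hull Λ ≃ₜ Tiling.Hull Λ')
    (hh : Tiling.IsOrbitEquivalence h ∨ (Λ.IsFLC ∧ Λ'.IsFLC)) :
    ∃ C : Matrix (Fin d) (Fin d) ℝ, IsUnit C ∧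
      (∃ c : Tiling.WeakH1 Λ, Tiling.IsWeakClassOf h c ∧
        (∀ c', Tiling.IsWeakClassOf h c' → c' = c) ∧ Tiling.IsRuelleSullivanWeak μ c C) ∧
      (Λ.IsFLC → Λ'.IsFLC →
        ∃ c : Tiling.StrongH1 Λ, Tiling.IsStrongClassOf h c ∧
          (∀ c', Tiling.IsStrongClassOf h c' → c' = c) ∧ Tiling.IsRuelleSullivanStrong μ c C) := by
  obtain ⟨α, hα, K, hK⟩ := Tiling.exists_isCocycleOf_norm_le haper haper' h hh
  have hc : Tiling.IsWeakClassOf h (QuotientAddGroup.mk α) := ⟨α, hα, rfl⟩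
  refine ⟨Tiling.Hull.ruelleSullivanMatrix μ (QuotientAddGroup.mk α),
    Tiling.Hull.isUnit_ruelleSullivanMatrix hK,
    ⟨_, hc, fun c' hc' => hc'.unique haper' hc,
      Tiling.Hull.isRuelleSullivanWeak_ruelleSullivanMatrix _⟩,
    fun hΛ hΛ' => ?_⟩
  obtain ⟨c, hc⟩ := Tiling.exists_isStrongClassOf haper' hΛ hΛ' hα
  exact ⟨c, hc, fun c' hc' => hc'.unique haper' hc, hc.isRuelleSullivanStrong haper' hα⟩

theorem mainTheorem3 {d : ℕ} {X Y : Type*} [MetricSpace X] [CompactSpace X]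
    [MetricSpace Y] [CompactSpace Y]
    (Λ : Tiling.DeloneSet d X) (Λ' : Tiling.DeloneSet d Y)
    (hmin : Tiling.IsMinimal Λ) (hmin' : Tiling.IsMinimal Λ')
    (haper : Tiling.IsAperiodic Λ) (haper' : Tiling.IsAperiodic Λ')
    (μ : MeasureTheory.Measure (Tiling.Hull Λ)) (hμ : Tiling.IsUniquelyErgodic μ)
    (h : Tiling.Hull Λ ≃ₜ Tiling.Hull Λ')
    (hh : Tiling.IsOrbitEquivalence h ∨ (Λ.IsFLC ∧ Λ'.IsFLC)) :
    ∃ C : Matrix (Fin d) (Fin d) ℝ, IsUnit C ∧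
      (∃ c : Tiling.WeakH1 Λ, Tiling.IsWeakClassOf h c ∧
        (∀ c', Tiling.IsWeakClassOf h c' → c' = c) ∧ Tiling.IsRuelleSullivanWeak μ c C) ∧
      (Λ.IsFLC → Λ'.IsFLC →
        ∃ c : Tiling.StrongH1 Λ, Tiling.IsStrongClassOf h c ∧
          (∀ c', Tiling.IsStrongClassOf h c' → c' = c) ∧ Tiling.IsRuelleSullivanStrong μ c C) := by
  have := hμ.1.isProbability
  have := hμ.ergodicVAdd
  exact mainTheorem3_general Λ Λ' haper haper' μ h hh
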